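/- A set-theoretic solution of the Yang--Baxter equation is a pair $(X,r)$ with $X$ a nonempty set and $r\colon X\times X\to X\times X$ a map such that $r_{12}r_{23}r_{12}=r_{23}r_{12}r_{23}$ on $X^3$, where $r_{12}=r\times\mathrm{id}_X$ and $r_{23}=\mathrm{id}_X\times r$. Write $r(x,y)=(f_x(y),g_y(x))$. The solution is involutive if $r^2=\mathrm{id}_{X\times X}$, and non-degenerate if the maps $f_x$ and $g_y$ are bijective for all $x,y\in X$. If $(X,r)$ is an involutive, non-degenerate solution, its permutation group is the subgroup $\mathcal{G}(X,r)=\langle f_x\mid x\in X\rangle$ of $\mathrm{Sym}(X)$. A group is called an involutive Yang--Baxter group (IYB-group) if it is isomorphic to $\mathcal{G}(X,r)$ for some involutive, non-degenerate set-theoretic solution $(X,r)$ of the Yang--Baxter equation. Theorem. Let $G$ be a finite soluble group all of whose Sylow subgroups have nilpotency class at most two. If the Sylow $2$-subgroups of $G$ are isomorphic to the quaternion group $Q_8$ of order $8$, then $G$ is an IYB-group. -/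

import Mathlib

/-- The map `r₁₂ = r × id` on `X³`. -/
def ybR12 {X : Type*} (r : X × X → X × X) (t : X × X × X) : X × X × X :=
  ((r (t.1, t.2.1)).1, (r (t.1, t.2.1)).2, t.2.2)

/-- The map `r₂₃ = id × r` on `X³`. -/
def ybR23 {X : Type*} (r : X × X → X × X) (t : X × X × X) : X × X × X :=
  (t.1, r t.2)

/-- `r` is a solution of the YBE on the nonempty set `X`: an involutive, non-degenerate
set-theoretic solution of the Yang-Baxter equation. Writing `r (x, y) = (f x y, g y x)`,
non-degenerate means that all the maps `f x` and `g y` are bijective. -/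
structure IsYBESolution {X : Type*} (r : X × X → X × X) : Prop where
  nonempty : Nonempty X
  yang_baxter : ybR12 r ∘ ybR23 r ∘ ybR12 r = ybR23 r ∘ ybR12 r ∘ ybR23 r
  involutive : r ∘ r = id
  bijective_left : ∀ x : X, Function.Bijective fun y : X => (r (x, y)).1
  bijective_right : ∀ y : X, Function.Bijective fun x : X => (r (x, y)).2

/-- The permutation group `𝒢(X, r)` of a solution: the subgroup of `Sym(X)` generated by the
bijections `f x : y ↦ (r (x, y)).1`, for `x` in `X`. -/
noncomputable def ybPermutationGroup {X : Type*} (r : X × X → X × X) (hr : IsYBESolution r) :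
    Subgroup (Equiv.Perm X) :=
  Subgroup.closure (Set.range fun x : X =>
    Equiv.ofBijective (fun y : X => (r (x, y)).1) (hr.bijective_left x))

/-- `G` is an involutive Yang-Baxter group (IYB-group): it is isomorphic to the permutation group
of some involutive, non-degenerate set-theoretic solution of the Yang-Baxter equation. -/
def IsIYBGroup.{u} (G : Type u) [Group G] : Prop :=
  ∃ (X : Type u) (r : X × X → X × X) (hr : IsYBESolution r),
    Nonempty (G ≃* ybPermutationGroup r hr)

-- A brace structure on `G`, an abelian addition for which left multiplications are affine, makes
-- `G` an IYB-group. For finite `G` it comes from a transitive affine action on an abelian group of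
-- order `|G|`. Such actions multiply over coprime orders, so it suffices to treat each prime `p`
-- separately, with an abelian group whose order is the `p`-part of `|G|`. That action may be pulled
-- back from the quotient by a normal `p'`-subgroup.
--
-- If a Sylow `p`-subgroup `N` is normal, it has a complement `J`, and a `J`-invariant brace
-- structure on `N` is enough. For odd `p` and class two, Baer's sum `a b [b,a]^(1/2)` works. For
-- `Q₈`, where commutators cannot be halved, a non-symmetric bilinear form over `𝔽₂` on `Q₈` modulo
-- its centre replaces the half commutator; automorphisms of odd order preserve it. For `p = 2` this
-- suffices, since `G` modulo its largest normal subgroup of odd order has a normal Sylow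
-- `2`-subgroup.
--
-- For odd `p`, class two makes elements of a Sylow `p`-subgroup act quadratically on the Frattini
-- quotient of a normal `p`-subgroup. In a solvable linear group of odd characteristic, quadratic
-- elements centralise normal `p'`-subgroups with abelian Sylow `2`-subgroups
-- (`commute_of_quadratic`). So if the Sylow `2`-subgroups are abelian, `G/O_p'(G)` has a normal
-- Sylow `p`-subgroup.
--
-- Quaternion Sylow subgroups obstruct this, as `SL₂(3)` shows. Let `M = O_2'(G)` and factor out `M
-- ∩ O_p'(G)`; then `M` has a normal Sylow `p`-subgroup `N`. If `p` does not divide `|G : M|`, then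
-- `N` is Sylow in `G`. Otherwise some involution `z` is central modulo `Z(N)`, and `G = B ⋊ C_G(z)`
-- with `B` the part of `Z(N)` inverted by `z`. As `C_G(z)/⟨z⟩` has abelian Sylow `2`-subgroups, the
-- previous case applies to it, and `B` is put back.

universe u v

open scoped commutatorElement

/-! ### Braces and the solutions they define. -/

section Brace

variable {G : Type u} [Group G] [AddCommGroup G]

/-- The map `λ_a` of a brace. -/
def braceLambda (a b : G) : G := a * b - a

theorem brace_one_eq_zero (h : ∀ a b c : G, a * (b + c) + a = a * b + a * c) : (1 : G) = 0 := by
  simpa using h 1 0 0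

theorem braceLambda_mul (h : ∀ a b c : G, a * (b + c) + a = a * b + a * c) (a b c : G) :
    braceLambda (a * b) c = braceLambda a (braceLambda b c) := by
  have h1 := h a (b * c - b) b
  rw [sub_add_cancel] at h1
  simp only [braceLambda, mul_assoc]
  rw [sub_eq_sub_iff_add_eq_add, h1]

theorem braceLambda_one (h : ∀ a b c : G, a * (b + c) + a = a * b + a * c) (a : G) :
    braceLambda 1 a = a := by
  rw [braceLambda, one_mul, brace_one_eq_zero h, sub_zero]

theorem braceLambda_eq_mul (h : ∀ a b c : G, a * (b + c) + a = a * b + a * c) (a b : G) :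
    braceLambda a b = a * (a⁻¹ + b) := by
  have h1 := h a a⁻¹ b
  rw [mul_inv_cancel, brace_one_eq_zero h, zero_add] at h1
  rw [braceLambda, ← h1, add_sub_cancel_right]

/-- The solution on `G × G` attached to a brace structure on `G`, whose permutation group is
`G`. -/
def braceSolution (p : (G × G) × (G × G)) : (G × G) × (G × G) :=
  ((braceLambda p.1.1 p.2.1, p.1.1 * p.2.2),
    ((braceLambda p.1.1 p.2.1)⁻¹ * (p.1.1 * p.2.1), (braceLambda p.1.1 p.2.1)⁻¹ * p.1.2))

theorem isYBESolution_braceSolution (h : ∀ a b c : G, a * (b + c) + a = a * b + a * c) :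
    IsYBESolution (braceSolution (G := G)) where
  nonempty := ⟨(1, 1)⟩
  yang_baxter := by
    funext t
    obtain ⟨⟨a, b⟩, ⟨c, d⟩, ⟨e, f⟩⟩ := t
    have key : ∀ a b : G, braceLambda a b * ((braceLambda a b)⁻¹ * (a * b)) = a * b :=
      fun a b => mul_inv_cancel_left _ _
    have h1 : ∀ a c e : G, braceLambda (braceLambda a c)
        (braceLambda ((braceLambda a c)⁻¹ * (a * c)) e) = braceLambda a (braceLambda c e) := by
      intro a c e
      rw [← braceLambda_mul h, key, braceLambda_mul h]
    have mul_eq : ∀ a b : G, a * b = a + braceLambda a b := fun a b => by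
      rw [braceLambda]; abel
    -- Both sides are the sum of `λ_a(c)` and `λ_a(λ_c(e))`, in opposite orders.
    have h2 : ∀ a c e : G, braceLambda a c * braceLambda ((braceLambda a c)⁻¹ * (a * c)) e =
        braceLambda a (braceLambda c e) *
          braceLambda ((braceLambda a (braceLambda c e))⁻¹ * (a * braceLambda c e))
            ((braceLambda c e)⁻¹ * (c * e)) := by
      intro a c e
      rw [mul_eq (braceLambda a c), h1, mul_eq (braceLambda a (braceLambda c e)),
        ← braceLambda_mul h (braceLambda a (braceLambda c e)), key,
        braceLambda_mul h a (braceLambda c e)]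
      have : braceLambda (braceLambda c e) ((braceLambda c e)⁻¹ * (c * e)) = c := by
        rw [braceLambda, key, braceLambda, sub_sub_cancel]
      rw [this, add_comm]
    have h3 : ∀ a c e : G, (braceLambda ((braceLambda a c)⁻¹ * (a * c)) e)⁻¹ *
          (braceLambda a c)⁻¹ =
        (braceLambda ((braceLambda a (braceLambda c e))⁻¹ * (a * braceLambda c e))
            ((braceLambda c e)⁻¹ * (c * e)))⁻¹ * (braceLambda a (braceLambda c e))⁻¹ := by
      intro a c e
      rw [← mul_inv_rev, ← mul_inv_rev, h2]
    simp only [Function.comp, ybR12, ybR23, braceSolution, Prod.mk.injEq]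
    refine ⟨⟨h1 a c e, by group⟩, ⟨?_, ?_⟩, ?_, ?_⟩
    · rw [h1, h2, inv_mul_cancel_left]
    · rw [h1]; group
    · have := h3 a c e
      have h4 : (braceLambda a (braceLambda c e))⁻¹ * (a * braceLambda c e) *
          ((braceLambda c e)⁻¹ * (c * e)) = (braceLambda a (braceLambda c e))⁻¹ * (a * c * e) := by
        group
      rw [h4, ← mul_assoc _ (braceLambda a (braceLambda c e))⁻¹, ← this]
      simp only [mul_assoc]
    · have := h3 a c e
      simp only [← mul_assoc] at this ⊢
      rw [this]
  involutive := by
    funext t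
    obtain ⟨⟨a, b⟩, ⟨c, d⟩⟩ := t
    have : braceLambda (braceLambda a c) ((braceLambda a c)⁻¹ * (a * c)) = a := by
      rw [braceLambda, mul_inv_cancel_left, braceLambda, sub_sub_cancel]
    simp [braceSolution, this]
  bijective_left := by
    rintro ⟨a, b⟩
    refine Function.bijective_iff_has_inverse.mpr
      ⟨fun y => (braceLambda a⁻¹ y.1, a⁻¹ * y.2), fun y => ?_, fun y => ?_⟩ <;>
    simp [braceSolution, ← braceLambda_mul h, braceLambda_one h]
  bijective_right := by
    rintro ⟨c, d⟩
    refine Function.bijective_iff_has_inverse.mpr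
      -- From `λ_a(c) = a (a⁻¹ + c)` the first coordinate of the image is `(a⁻¹ + c)⁻¹ c`, which is
      -- solved for `a`.
      ⟨fun x => ((c * x.1⁻¹ - c)⁻¹, (c * x.1⁻¹ - c)⁻¹ * (c * x.1⁻¹) * x.2),
        fun x => ?_, fun x => ?_⟩ <;>
    simp [braceSolution, braceLambda_eq_mul h, mul_assoc]

/-- The maps `λ_a` alone need not be faithful in `a`. Left multiplication on the second coordinate
makes them so, and the permutation attached to `(a, b)` depends only on `a`. -/
theorem isIYBGroup_of_brace (h : ∀ a b c : G, a * (b + c) + a = a * b + a * c) :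
    IsIYBGroup G := by
  refine ⟨G × G, braceSolution, isYBESolution_braceSolution h, ?_⟩
  have hr := isYBESolution_braceSolution h
  let f : G →* Equiv.Perm (G × G) := MonoidHom.mk'
    (fun a => Equiv.ofBijective (fun y : G × G => (braceSolution ((a, 1), y)).1)
      (hr.bijective_left (a, 1)))
    (fun a b => Equiv.ext fun y => by simp [braceSolution, braceLambda_mul h, mul_assoc])
  have hf : Function.Injective f := by
    intro a b hab
    have := congrArg (fun e : Equiv.Perm (G × G) => (e (1, 1)).2) hab
    simpa [f, braceSolution] using this
  have hrange : f.range = ybPermutationGroup braceSolution hr := by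
    rw [ybPermutationGroup, ← Subgroup.closure_eq f.range]
    congr 1
    ext e
    simp only [SetLike.mem_coe, MonoidHom.mem_range, Set.mem_range]
    constructor
    · rintro ⟨a, rfl⟩
      exact ⟨(a, 1), rfl⟩
    · rintro ⟨⟨a, b⟩, rfl⟩
      exact ⟨a, Equiv.ext fun y => rfl⟩
  exact ⟨(MonoidHom.ofInjective hf).trans (MulEquiv.subgroupCongr hrange)⟩

end Brace

/-! ### Transitive affine actions. -/

/-- `G` acts on an abelian group of order `n` by affine maps, transitively. -/
def HasAffineAction (G : Type u) [Group G] (n : ℕ) : Prop :=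
  ∃ (A : Type u) (_ : AddCommGroup A) (σ : G →* Equiv.Perm A), Nat.card A = n ∧
    (∀ g a b, σ g (a + b) + σ g 0 = σ g a + σ g b) ∧ ∀ a, ∃ g, σ g 0 = a

namespace HasAffineAction

/-- Equal orders make the orbit map of `0` bijective. Pulling the addition back along it turns left
multiplication into the affine action, and affinity is the brace identity. -/
theorem isIYBGroup {G : Type u} [Group G] [Finite G] (h : HasAffineAction G (Nat.card G)) :
    IsIYBGroup G := by
  obtain ⟨A, _, σ, hcard, haff, htrans⟩ := h
  have : Finite A := Finite.of_surjective (fun g => σ g 0) htrans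
  have hbij : Function.Bijective fun g => σ g 0 :=
    (Nat.bijective_iff_surjective_and_card _).mpr ⟨htrans, hcard.symm⟩
  let e : G ≃ A := Equiv.ofBijective _ hbij
  let := e.addCommGroup
  have hadd : ∀ a b : G, e (a + b) = e a + e b := fun a b => e.apply_symm_apply _
  have hmul : ∀ a b : G, e (a * b) = σ a (e b) := fun a b => by
    change σ (a * b) 0 = σ a (σ b 0)
    rw [map_mul, Equiv.Perm.mul_apply]
  refine isIYBGroup_of_brace fun a b c => e.injective ?_
  rw [hadd, hadd, hmul, hmul, hmul, hadd]
  exact haff a (e b) (e c)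

theorem one (G : Type u) [Group G] : HasAffineAction G 1 :=
  ⟨PUnit, inferInstance, 1, by simp, fun _ _ _ => rfl, fun _ => ⟨1, rfl⟩⟩

theorem comap {G : Type u} {G' : Type u} [Group G] [Group G'] {n : ℕ} (f : G →* G')
    (hf : Function.Surjective f) (h : HasAffineAction G' n) : HasAffineAction G n := by
  obtain ⟨A, inst, σ, hcard, haff, htrans⟩ := h
  refine ⟨A, inst, σ.comp f, hcard, fun g => haff (f g), fun a => ?_⟩
  obtain ⟨g', hg'⟩ := htrans a
  obtain ⟨g, rfl⟩ := hf g'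
  exact ⟨g, hg'⟩

/-- The stabiliser of `(0, 0)` lies in both point stabilisers, so its index is divisible by `m` and
by `n`. Coprimality makes the product action transitive. -/
theorem mul_of_coprime {G : Type u} [Group G] [Finite G] {m n : ℕ} (hmn : m.Coprime n)
    (hm : HasAffineAction G m) (hn : HasAffineAction G n) : HasAffineAction G (m * n) := by
  obtain ⟨A, instA, σ, hcardA, haffA, htransA⟩ := hm
  obtain ⟨B, instB, τ, hcardB, haffB, htransB⟩ := hn
  have : Finite A := Finite.of_surjective (fun g => σ g 0) htransA
  have : Finite B := Finite.of_surjective (fun g => τ g 0) htransB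
  refine ⟨A × B, inferInstance,
    MonoidHom.mk' (fun g => (σ g).prodCongr (τ g)) (fun g h => by ext x <;> simp), ?_, ?_, ?_⟩
  · rw [Nat.card_prod, hcardA, hcardB]
  · intro g a b
    exact Prod.ext (haffA g a.1 b.1) (haffB g a.2 b.2)
  · let := MulAction.compHom A σ
    let := MulAction.compHom B τ
    have hA : (MulAction.stabilizer G (0 : A)).index = m := by
      rw [MulAction.index_stabilizer, ← hcardA, ← Set.ncard_univ]
      exact congrArg _ (Set.eq_univ_of_forall fun a => htransA a)
    have hB : (MulAction.stabilizer G (0 : B)).index = n := by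
      rw [MulAction.index_stabilizer, ← hcardB, ← Set.ncard_univ]
      exact congrArg _ (Set.eq_univ_of_forall fun a => htransB a)
    have hdA : m ∣ (MulAction.stabilizer G ((0, 0) : A × B)).index := by
      rw [← hA]
      exact Subgroup.index_dvd_of_le fun g hg => (Prod.ext_iff.mp hg).1
    have hdB : n ∣ (MulAction.stabilizer G ((0, 0) : A × B)).index := by
      rw [← hB]
      exact Subgroup.index_dvd_of_le fun g hg => (Prod.ext_iff.mp hg).2
    have hle := Nat.le_of_dvd (Nat.pos_of_ne_zero Subgroup.index_ne_zero_of_finite)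
      (hmn.mul_dvd_of_dvd_of_dvd hdA hdB)
    rw [MulAction.index_stabilizer] at hle
    have huniv : MulAction.orbit G ((0, 0) : A × B) = Set.univ := by
      refine Set.eq_of_subset_of_ncard_le (Set.subset_univ _) ?_
      rw [Set.ncard_univ, Nat.card_prod, hcardA, hcardB]
      exact hle
    intro a
    exact (huniv ▸ Set.mem_univ a : a ∈ MulAction.orbit G ((0, 0) : A × B))

theorem card_of_forall_prime {G : Type u} [Group G] [Finite G]
    (h : ∀ p : ℕ, p.Prime → HasAffineAction G (p ^ (Nat.card G).factorization p)) :
    HasAffineAction G (Nat.card G) := by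
  have key : ∀ s : Finset ℕ, (∀ p ∈ s, p.Prime) →
      HasAffineAction G (∏ p ∈ s, p ^ (Nat.card G).factorization p) := by
    intro s
    induction s using Finset.induction_on with
    | empty => exact fun _ => one G
    | insert p s hps ih =>
      intro hs
      rw [Finset.prod_insert hps]
      refine mul_of_coprime ?_ (h p (hs p (Finset.mem_insert_self p s)))
        (ih fun q hq => hs q (Finset.mem_insert_of_mem hq))
      refine Nat.Coprime.prod_right fun q hq => Nat.Coprime.pow _ _ ?_
      rw [Nat.coprime_primes (hs p (Finset.mem_insert_self p s))
        (hs q (Finset.mem_insert_of_mem hq))]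
      rintro rfl
      exact hps hq
  have := key (Nat.card G).primeFactors fun p hp => Nat.prime_of_mem_primeFactors hp
  rwa [Nat.prod_factorization_eq_prod_primeFactors .. |>.symm.trans
    (Nat.prod_factorization_pow_eq_self Nat.card_pos.ne')] at this

/-- If `G = B ⋊ J` with `B` the kernel and `J` the range of an idempotent endomorphism `p`, a
`J`-invariant brace structure on `B` and an affine action of `J` combine to an affine action
of `G`. -/
theorem of_retraction {G : Type u} [Group G] (p : G →* G) (hp : ∀ g, p (p g) = p g)
    [AddCommGroup p.ker]
    (hbrace : ∀ a b c : p.ker, a * (b + c) + a = a * b + a * c)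
    (hconj : ∀ g (a b : p.ker), MulAut.conjNormal (p g) (a + b) =
      MulAut.conjNormal (p g) a + MulAut.conjNormal (p g) b)
    {m : ℕ} (hJ : HasAffineAction p.range m) : HasAffineAction G (Nat.card p.ker * m) := by
  obtain ⟨A, instA, τ, hcardA, haffA, htransA⟩ := hJ
  have hmem : ∀ g (a : p.ker), g * a * (p g)⁻¹ ∈ p.ker := fun g a => by
    have := a.2
    rw [MonoidHom.mem_ker] at this
    simp [MonoidHom.mem_ker, hp, this]
  -- For `g = b j` this is `a ↦ b (j a j⁻¹)`: an additive conjugation followed by an affine left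
  -- multiplication.
  let s : G →* Function.End p.ker :=
    { toFun := fun g a => ⟨g * a * (p g)⁻¹, hmem g a⟩
      map_one' := by
        funext a
        ext
        change _ = (a : G)
        simp
      map_mul' := fun g h => by
        funext a
        ext
        change _ = g * (h * a * (p h)⁻¹) * (p g)⁻¹
        simp [mul_assoc] }
  have hsv : ∀ g a, (s g a : G) = g * a * (p g)⁻¹ := fun _ _ => rfl
  have h10 := brace_one_eq_zero hbrace
  have hs : ∀ g a, s g a = s g 1 * MulAut.conjNormal (p g) a := fun g a => by
    ext
    rw [Subgroup.coe_mul, hsv, hsv, MulAut.conjNormal_apply]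
    simp [mul_assoc]
  let σ : G →* Equiv.Perm (p.ker) := s.toHomPerm
  have hσ : ∀ g a, σ g a = s g a := fun g a => rfl
  refine ⟨p.ker × A, inferInstance,
    MonoidHom.mk' (fun g => (σ g).prodCongr (τ (p.rangeRestrict g)))
      (fun g h => by ext x <;> simp), ?_, ?_, ?_⟩
  · rw [Nat.card_prod, hcardA]
  · intro g a b
    refine Prod.ext ?_ (haffA _ a.2 b.2)
    change σ g (a.1 + b.1) + σ g 0 = σ g a.1 + σ g b.1
    rw [← h10, hσ, hσ, hσ, hσ, hs g (a.1 + b.1), hs g a.1, hs g b.1, hconj, hbrace]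
  · rintro ⟨b, a⟩
    obtain ⟨⟨j, g, hj⟩, hja⟩ := htransA a
    have hpj : p j = j := by rw [← hj, hp]
    have hb : p b = 1 := b.2
    refine ⟨b * j, Prod.ext ?_ ?_⟩
    · change σ (b * j) 0 = b
      rw [← h10, hσ]
      ext
      rw [hsv]
      simp [hpj, hb]
    · change τ (p.rangeRestrict (b * j)) 0 = a
      rw [← hja]
      congr 2
      ext
      simp [hpj, hb]

/-- A version of `HasAffineAction.of_retraction` for a normal subgroup and a complement. -/
theorem of_isComplement' {G : Type u} [Group G] {B J : Subgroup G} [B.Normal]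
    (hc : B.IsComplement' J) [AddCommGroup B]
    (hbrace : ∀ a b c : B, a * (b + c) + a = a * b + a * c)
    (hconj : ∀ g ∈ J, ∀ a b : B, MulAut.conjNormal g (a + b) =
      MulAut.conjNormal g a + MulAut.conjNormal g b)
    {m : ℕ} (hJ : HasAffineAction J m) : HasAffineAction G (Nat.card B * m) := by
  obtain ⟨p, rfl, rfl, hp⟩ : ∃ p : G →* G, p.ker = B ∧ p.range = J ∧ ∀ g, p (p g) = p g := by
    let e : G ⧸ B ≃* J := hc.symm.QuotientMulEquiv
    have he : ∀ j : J, e ((j : G) : G ⧸ B) = j := fun j => e.symm.injective (by simp; rfl)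
    refine ⟨J.subtype.comp (e.toMonoidHom.comp (QuotientGroup.mk' B)), ?_, ?_, ?_⟩
    · ext g
      simp [MonoidHom.mem_ker]
    · ext g
      simp only [MonoidHom.mem_range]
      constructor
      · rintro ⟨x, rfl⟩
        exact Subtype.prop _
      · intro hg
        exact ⟨g, congrArg Subtype.val (he ⟨g, hg⟩)⟩
    · intro g
      exact congrArg Subtype.val (he (e ((g : G) : G ⧸ B)))
  exact of_retraction p hp hbrace (fun g => hconj _ ⟨g, rfl⟩) hJ

end HasAffineAction

/-! ### Braces from central bilinear maps. -/

/-- A bilinear map `κ` into the centre, trivial on the centre, with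
`a b κ(b, a) = b a κ(a, b)` turns `P` into a brace with sum `a b κ(b, a)`. -/
theorem exists_brace_of_bilinear {P : Type u} [Group P] (κ : P → P → Subgroup.center P)
    (hml : ∀ a b c, κ (a * b) c = κ a c * κ b c) (hmr : ∀ a b c, κ a (b * c) = κ a b * κ a c)
    (hr : ∀ a (z : Subgroup.center P), κ a z = 1) (hl : ∀ (z : Subgroup.center P) a, κ z a = 1)
    (hsymm : ∀ a b, a * b * κ b a = b * a * κ a b) :
    ∃ _ : AddCommGroup P, (∀ a b c : P, a * (b + c) + a = a * b + a * c) ∧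
      ∀ a b : P, a + b = a * b * κ b a := by
  have hcomm : ∀ (z : Subgroup.center P) (a : P), (z : P) * a = a * z := fun z a =>
    (Subgroup.mem_center_iff.mp z.2 a).symm
  have hassoc : ∀ a b c : P, a * b * κ b a * c * κ c (a * b * κ b a) =
      a * (b * c * κ c b) * κ (b * c * κ c b) a := by
    intro a b c
    have h1 : κ c (a * b * κ b a) = κ c a * κ c b := by rw [hmr, hmr, hr, mul_one]
    have h2 : κ (b * c * κ c b) a = κ b a * κ c a := by
      rw [hml, hml, hl, mul_one]
    rw [h1, h2, Subgroup.coe_mul, Subgroup.coe_mul, mul_assoc (a * b), hcomm (κ b a) c]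
    have h3 : ((κ b a : P) * ((κ c a : P) * κ c b)) = κ c b * (κ b a * κ c a) := by
      rw [← mul_assoc, ← hcomm (κ c b)]
    calc a * b * (c * κ b a) * (κ c a * κ c b)
        = a * b * c * (κ b a * (κ c a * κ c b)) := by simp only [mul_assoc]
      _ = _ := by rw [h3]; simp only [mul_assoc]
  have hone : ∀ a, κ a 1 = 1 := fun a => hr a 1
  have hinv : ∀ a, κ a a⁻¹ = (κ a a)⁻¹ := fun a => by
    rw [eq_inv_iff_mul_eq_one, ← hmr, inv_mul_cancel, hone]
  let _ : Add P := ⟨fun a b => a * b * κ b a⟩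
  let _ : Zero P := ⟨1⟩
  let _ : Neg P := ⟨fun a => a⁻¹ * κ a a⟩
  let inst : AddCommGroup P :=
    { AddGroup.ofLeftAxioms (G := P) hassoc
        (fun a => by
          change 1 * a * (κ a 1 : P) = a
          rw [hone]; simp)
        (fun a => by
          change a⁻¹ * κ a a * a * (κ a (a⁻¹ * κ a a) : P) = 1
          rw [hmr, hr, mul_one, hinv, mul_assoc a⁻¹, hcomm, ← mul_assoc, inv_mul_cancel,
            one_mul, Subgroup.coe_inv, mul_inv_cancel]) with
      add_comm := fun a b => hsymm a b }
  have hadd : ∀ a b : P, a + b = a * b * κ b a := fun _ _ => rfl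
  refine ⟨inst, ?_, hadd⟩
  -- Thus `λ_a` is `x ↦ x κ(x, a)⁻¹`, and the brace identity reduces to the additivity of this map,
  -- which is `hμ`.
  have hmul : ∀ a x : P, a * x = a + x * ((κ x a)⁻¹ : Subgroup.center P) := fun a x => by
    rw [hadd, hml, hl, mul_one, Subgroup.coe_inv]
    simp [mul_assoc]
  have hμ : ∀ a b c : P, (b + c) * ((κ (b + c) a)⁻¹ : Subgroup.center P) =
      b * ((κ b a)⁻¹ : Subgroup.center P) + c * ((κ c a)⁻¹ : Subgroup.center P) := by
    intro a b c
    have h1 : κ (b + c) a = κ b a * κ c a := by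
      rw [hadd, hml, hml, hl, mul_one]
    have h2 : κ (c * ((κ c a)⁻¹ : Subgroup.center P))
        (b * ((κ b a)⁻¹ : Subgroup.center P)) = κ c b := by
      rw [hml, hmr, hr, hl, mul_one, mul_one]
    have h3 : (κ b a * κ c a)⁻¹ = (κ b a)⁻¹ * (κ c a)⁻¹ := by
      rw [mul_inv_rev]
      exact Subtype.ext (hcomm _ _)
    rw [hadd (b * _), h2, h1, hadd, h3, Subgroup.coe_mul]
    generalize (κ b a)⁻¹ = x
    generalize (κ c a)⁻¹ = y
    generalize κ c b = w
    calc b * c * w * (x * y : P) = b * c * (w * (x * y)) := by rw [mul_assoc]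
      _ = b * c * (x * y * w) := by rw [hcomm w]
      _ = b * (c * x) * (y * w) := by simp only [mul_assoc]
      _ = b * (x * c) * (y * w) := by rw [hcomm x]
      _ = b * x * (c * y) * w := by simp only [mul_assoc]
  intro a b c
  rw [hmul a (b + c), hmul a b, hmul a c, hμ]
  abel

/-- The Baer sum: a finite group of odd order and class at most two is a brace, in a way that is
invariant under all automorphisms. -/
theorem exists_brace_of_odd_of_class_two {P : Type u} [Group P] [Finite P]
    (hodd : Odd (Nat.card P)) (h2 : ∀ a b c : P, ⁅⁅a, b⁆, c⁆ = 1) :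
    ∃ _ : AddCommGroup P, (∀ a b c : P, a * (b + c) + a = a * b + a * c) ∧
      ∀ (φ : MulAut P) (a b : P), φ (a + b) = φ a + φ b := by
  obtain ⟨k, hk⟩ := hodd
  have hz : ∀ a b : P, ⁅a, b⁆ ∈ Subgroup.center P := fun a b => by
    rw [Subgroup.mem_center_iff]
    intro c
    exact ((commutatorElement_eq_one_iff_mul_comm).mp (h2 a b c)).symm
  let c : P → P → Subgroup.center P := fun a b => ⟨⁅a, b⁆, hz a b⟩
  have hcr : ∀ a b d, c a (b * d) = c a b * c a d := fun a b d => by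
    ext
    change ⁅a, b * d⁆ = ⁅a, b⁆ * ⁅a, d⁆
    have h1 : ⁅a, b * d⁆ = ⁅a, b⁆ * (b * ⁅a, d⁆ * b⁻¹) := by
      simp only [commutatorElement_def]; group
    rw [h1, Subgroup.mem_center_iff.mp (hz a d) b, mul_inv_cancel_right]
  have hcl : ∀ a b d, c (a * b) d = c a d * c b d := fun a b d => by
    ext
    change ⁅a * b, d⁆ = ⁅a, d⁆ * ⁅b, d⁆
    have h1 : ⁅a * b, d⁆ = (a * ⁅b, d⁆ * a⁻¹) * ⁅a, d⁆ := by
      simp only [commutatorElement_def]; group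
    rw [h1, Subgroup.mem_center_iff.mp (hz b d) a, mul_inv_cancel_right,
      Subgroup.mem_center_iff.mp (hz b d)]
  have hcc : ∀ x y : Subgroup.center P, Commute x y := fun x y =>
    Subtype.ext (Subgroup.mem_center_iff.mp y.2 x)
  -- As `|P| = 2k + 1`, the exponent `k + 1` is one half: `κ a b` is the square root of the
  -- commutator.
  let κ : P → P → Subgroup.center P := fun a b => c a b ^ (k + 1)
  have hκv : ∀ a b, (κ a b : P) = ⁅a, b⁆ ^ (k + 1) := fun _ _ => rfl
  obtain ⟨inst, hb, hadd⟩ := exists_brace_of_bilinear κ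
    (fun a b d => by simp only [κ]; rw [hcl, (hcc _ _).mul_pow])
    (fun a b d => by simp only [κ]; rw [hcr, (hcc _ _).mul_pow])
    (fun a z => by
      ext
      rw [hκv, commutatorElement_eq_one_iff_mul_comm.mpr (Subgroup.mem_center_iff.mp z.2 a)]
      simp)
    (fun z a => by
      ext
      rw [hκv, commutatorElement_eq_one_iff_mul_comm.mpr (Subgroup.mem_center_iff.mp z.2 a).symm]
      simp)
    (fun a b => by
      have h1 : κ b a = (κ a b)⁻¹ := by
        ext
        rw [Subgroup.coe_inv, hκv, hκv, ← inv_pow, commutatorElement_inv]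
      have h3 : (κ a b : P) * κ a b = ⁅a, b⁆ := by
        rw [hκv, ← pow_add, show k + 1 + (k + 1) = Nat.card P + 1 by omega, pow_succ,
          pow_card_eq_one', one_mul]
      have h4 : a * b = b * a * ⁅a, b⁆ := by
        rw [Subgroup.mem_center_iff.mp (hz a b), commutatorElement_def]; group
      rw [h1, h4, ← h3, Subgroup.coe_inv]
      simp [mul_assoc])
  refine ⟨inst, hb, fun φ a b => ?_⟩
  rw [hadd, hadd, hκv, hκv, map_mul, map_mul, map_pow, map_commutatorElement]

/-! ### An invariant brace structure on `Q₈`. -/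

namespace QuaternionGroup

/-- The class of an element of `Q₈` modulo the centre, as a vector over `𝔽₂`. -/
def modCenter : QuaternionGroup 2 → ZMod 2 × ZMod 2
  | a i => (i.val, 0)
  | xa i => (i.val, 1)

/-- A bilinear form on `Q₈` with values in the centre, whose quadratic form is the squaring map,
invariant under automorphisms of odd order. -/
def form (g h : QuaternionGroup 2) : QuaternionGroup 2 :=
  a (2 * (((modCenter g).1 * (modCenter h).1 + (modCenter g).1 * (modCenter h).2 +
    (modCenter g).2 * (modCenter h).2).val : ZMod 4))

theorem form_mul_right : ∀ g h k : QuaternionGroup 2, form g (h * k) = form g h * form g k := by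
  decide +kernel

theorem form_mul_left : ∀ g h k : QuaternionGroup 2, form (g * h) k = form g k * form h k := by
  decide +kernel

theorem form_comm : ∀ g h k : QuaternionGroup 2, form g h * k = k * form g h := by
  decide +kernel

theorem form_symm : ∀ g h : QuaternionGroup 2, g * h * form h g = h * g * form g h := by
  decide +kernel

theorem form_of_central : ∀ z : QuaternionGroup 2, (∀ k, k * z = z * k) →
    ∀ g, form g z = 1 ∧ form z g = 1 := by
  decide +kernel

/-- An automorphism sends `a 1`, `xa 0` to such a pair. Modulo the centre it acts as an element of
`GL₂(2) ≅ S₃`, whose elements of order three preserve the form and whose transpositions transpose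
it. -/
theorem form_pair : ∀ u v : QuaternionGroup 2, u * u = a 2 → v * v = a 2 → u * v ≠ v * u →
    (∀ i j : Fin 4, ∀ k l : Fin 2, form (u ^ i.val * v ^ k.val) (u ^ j.val * v ^ l.val) =
      form (a 1 ^ i.val * xa 0 ^ k.val) (a 1 ^ j.val * xa 0 ^ l.val)) ∨
    (∀ i j : Fin 4, ∀ k l : Fin 2, form (u ^ i.val * v ^ k.val) (u ^ j.val * v ^ l.val) =
      form (a 1 ^ j.val * xa 0 ^ l.val) (a 1 ^ i.val * xa 0 ^ k.val)) := by
  decide +kernel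

theorem exists_pow_mul_pow : ∀ g : QuaternionGroup 2, ∃ i : Fin 4, ∃ k : Fin 2,
    g = a 1 ^ i.val * xa 0 ^ k.val := by
  decide +kernel

theorem mul_self_of_ne_one : ∀ u : QuaternionGroup 2, u * u ≠ 1 → u * u = a 2 := by
  decide +kernel

theorem form_eq_one_or : ∀ u v : QuaternionGroup 2, form u v = 1 ∨ form u v = a 1 * a 1 := by
  decide +kernel

theorem form_map_or (φ : MulAut (QuaternionGroup 2)) :
    (∀ g h, form (φ g) (φ h) = form g h) ∨ ∀ g h, form (φ g) (φ h) = form h g := by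
  have hsq : ∀ u : QuaternionGroup 2, u * u ≠ 1 → φ u * φ u = a 2 := fun u hu =>
    mul_self_of_ne_one _ fun h => hu (φ.injective (by rw [map_mul, h, map_one]))
  have := form_pair (φ (a 1)) (φ (xa 0)) (hsq _ (by decide)) (hsq _ (by decide)) (by
    rw [← map_mul, ← map_mul]
    exact fun h => absurd (φ.injective h) (by decide))
  refine this.imp (fun H g h => ?_) fun H g h => ?_
  all_goals
    obtain ⟨i, k, rfl⟩ := exists_pow_mul_pow g
    obtain ⟨j, l, rfl⟩ := exists_pow_mul_pow h
    simpa only [map_mul, map_pow] using H i j k l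

/-- If `φ` transposed the form, so would all its odd powers, among them the identity; but the form
is not symmetric. -/
theorem form_map_of_odd (φ : MulAut (QuaternionGroup 2)) (hφ : Odd (orderOf φ))
    (g h : QuaternionGroup 2) : form (φ g) (φ h) = form g h := by
  refine (form_map_or φ).resolve_right (fun hF => ?_) g h
  have key : ∀ n, ∀ g h, form ((φ ^ (2 * n + 1)) g) ((φ ^ (2 * n + 1)) h) = form h g := by
    intro n
    induction n with
    | zero => simpa using hF
    | succ n ih =>
      intro g h
      rw [show 2 * (n + 1) + 1 = (2 * n + 1) + 1 + 1 by ring, pow_succ, pow_succ]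
      simp only [MulAut.mul_apply]
      rw [ih, hF, hF]
  obtain ⟨n, hn⟩ := hφ
  have := key n (a 1) (xa 0)
  rw [← hn, pow_orderOf_eq_one] at this
  exact absurd this (by decide +kernel)

end QuaternionGroup

open QuaternionGroup in
theorem exists_brace_quaternionGroup :
    ∃ _ : AddCommGroup (QuaternionGroup 2),
      (∀ a b c : QuaternionGroup 2, a * (b + c) + a = a * b + a * c) ∧
      ∀ (φ : MulAut (QuaternionGroup 2)), Odd (orderOf φ) →
        ∀ a b : QuaternionGroup 2, φ (a + b) = φ a + φ b := by
  have hz : ∀ g h, form g h ∈ Subgroup.center (QuaternionGroup 2) := fun g h =>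
    Subgroup.mem_center_iff.mpr fun k => (form_comm g h k).symm
  let κ : QuaternionGroup 2 → QuaternionGroup 2 → Subgroup.center (QuaternionGroup 2) :=
    fun g h => ⟨form g h, hz g h⟩
  have hκ : ∀ g h, (κ g h : QuaternionGroup 2) = form g h := fun _ _ => rfl
  obtain ⟨inst, hb, hadd⟩ := exists_brace_of_bilinear κ
    (fun g h k => Subtype.ext (form_mul_left g h k))
    (fun g h k => Subtype.ext (form_mul_right g h k))
    (fun g z => Subtype.ext (form_of_central z (Subgroup.mem_center_iff.mp z.2) g).1)
    (fun z g => Subtype.ext (form_of_central z (Subgroup.mem_center_iff.mp z.2) g).2)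
    form_symm
  refine ⟨inst, hb, fun φ hφ g h => ?_⟩
  have hfix : ∀ u v, φ (form u v) = form u v := fun u v => by
    rcases form_eq_one_or u v with h | h
    · rw [h, map_one]
    · rw [h, map_mul, mul_self_of_ne_one (φ (a 1)) fun h => ?_]
      · decide
      · rw [← map_mul, ← map_one φ] at h
        exact absurd (φ.injective h) (by decide)
  rw [hadd, hadd, hκ, hκ, map_mul, map_mul, hfix, form_map_of_odd φ hφ]

/-- Transport of an invariant brace structure along an isomorphism. -/
theorem exists_brace_of_mulEquiv_quaternionGroup {P : Type u} [Group P]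
    (e : P ≃* QuaternionGroup 2) :
    ∃ _ : AddCommGroup P, (∀ a b c : P, a * (b + c) + a = a * b + a * c) ∧
      ∀ (φ : MulAut P), Odd (orderOf φ) → ∀ a b : P, φ (a + b) = φ a + φ b := by
  obtain ⟨inst, hb, hφ⟩ := exists_brace_quaternionGroup
  let inst' : AddCommGroup P := e.toEquiv.addCommGroup
  have hadd : ∀ a b : P, e (a + b) = e a + e b := fun a b => e.toEquiv.apply_symm_apply _
  refine ⟨inst', fun a b c => e.injective ?_, fun φ ho a b => e.injective ?_⟩
  · rw [hadd, hadd, map_mul, map_mul, map_mul, hadd, hb]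
  · have h1 := hφ (MulAut.congr e φ) (by rwa [MulEquiv.orderOf_eq]) (e a) (e b)
    rw [hadd, ← hadd a b] at *
    simpa using h1

/-! ### Affine actions from a normal Sylow subgroup. -/

theorem MulAut.orderOf_conjNormal_dvd {G : Type u} [Group G] {N : Subgroup G} [N.Normal] (g : G) :
    orderOf (MulAut.conjNormal g : MulAut N) ∣ orderOf g :=
  orderOf_map_dvd _ g

/-- Schur–Zassenhaus gives a complement `J` of order prime to `p`. Hence only conjugations by
`p'`-elements must be additive, and `J` may act on the trivial group. -/
theorem HasAffineAction.of_normal_sylow {G : Type u} [Group G] [Finite G] {p : ℕ} [Fact p.Prime]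
    {N : Subgroup G} [N.Normal] (hN : IsPGroup p N) (hindex : ¬ p ∣ N.index)
    (hbr : ∃ _ : AddCommGroup N, (∀ a b c : N, a * (b + c) + a = a * b + a * c) ∧
      ∀ g : G, ¬ p ∣ orderOf g → ∀ a b : N, MulAut.conjNormal g (a + b) =
        MulAut.conjNormal g a + MulAut.conjNormal g b) :
    HasAffineAction G (p ^ (Nat.card G).factorization p) := by
  obtain ⟨inst, hb, hconj⟩ := hbr
  have hcard : Nat.card N = p ^ (Nat.card G).factorization p :=
    (hN.toSylow hindex).card_eq_multiplicity
  have hcop : (Nat.card N).Coprime N.index := by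
    rw [hcard]
    exact Nat.Coprime.pow_left _ ((Nat.Prime.coprime_iff_not_dvd Fact.out).mpr hindex)
  obtain ⟨J, hJ⟩ := Subgroup.exists_right_complement'_of_coprime hcop
  have := HasAffineAction.of_isComplement' hJ hb (fun g hg => hconj g fun h => hindex ?_)
    (HasAffineAction.one J)
  · rwa [mul_one, hcard] at this
  · rw [hJ.symm.index_eq_card]
    exact h.trans (Subgroup.orderOf_dvd_natCard J hg)

theorem HasAffineAction.of_normal_sylow_of_class_two {G : Type u} [Group G] [Finite G] {p : ℕ}
    [Fact p.Prime] (hp2 : p ≠ 2) {N : Subgroup G} [N.Normal] (hN : IsPGroup p N)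
    (hindex : ¬ p ∣ N.index) (h2 : ∀ a ∈ N, ∀ b ∈ N, ∀ c ∈ N, ⁅⁅a, b⁆, c⁆ = 1) :
    HasAffineAction G (p ^ (Nat.card G).factorization p) := by
  have hodd : Odd (Nat.card N) := by
    obtain ⟨n, hn⟩ := IsPGroup.iff_card.mp hN
    rw [hn]
    exact ((Fact.out : p.Prime).odd_of_ne_two hp2).pow
  obtain ⟨inst, hb, hφ⟩ := exists_brace_of_odd_of_class_two hodd
    fun a b c => Subtype.ext (h2 a a.2 b b.2 c c.2)
  exact of_normal_sylow hN hindex ⟨inst, hb, fun g _ => hφ _⟩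

theorem HasAffineAction.of_normal_quaternionGroup {G : Type u} [Group G] [Finite G]
    {N : Subgroup G} [N.Normal] (e : N ≃* QuaternionGroup 2) (hindex : ¬ 2 ∣ N.index) :
    HasAffineAction G (2 ^ (Nat.card G).factorization 2) := by
  have hN : IsPGroup 2 N := IsPGroup.of_card (n := 3) (by
    rw [Nat.card_congr e.toEquiv, Nat.card_eq_fintype_card, QuaternionGroup.card]
    norm_num)
  obtain ⟨inst, hb, hφ⟩ := exists_brace_of_mulEquiv_quaternionGroup e
  refine of_normal_sylow hN hindex ⟨inst, hb, fun g hg => hφ _ ?_⟩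
  rw [← Nat.not_even_iff_odd, even_iff_two_dvd]
  exact fun h => hg (h.trans (MulAut.orderOf_conjNormal_dvd g))

/-! ### Quadratic elements in odd characteristic. -/

section Quadratic

variable {E : Type v} [Ring E] {p : ℕ} [hp : Fact p.Prime] [CharP E p]

theorem eq_zero_of_two_mul_eq_zero_of_charP (hp2 : p ≠ 2) {x : E} (h : 2 * x = 0) : x = 0 := by
  obtain ⟨k, hk⟩ := hp.out.odd_of_ne_two hp2
  have h1 : (p : E) * x = 0 := by rw [CharP.cast_eq_zero, zero_mul]
  have h2 : (p : E) * x = k * (2 * x) + x := by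
    rw [hk]; push_cast; noncomm_ring
  rw [h2, h, mul_zero, zero_add] at h1
  exact h1

theorem pow_char_eq_one_of_sq_eq_zero (p : ℕ) [hp : Fact p.Prime] [CharP E p] {x : E}
    (hx : (x - 1) ^ 2 = 0) : x ^ p = 1 := by
  have h := add_pow_char_of_commute p (x := x - 1) (y := 1) (Commute.one_right _)
  have h2 : (x - 1) ^ p = 0 := by
    rw [← Nat.add_sub_of_le hp.out.two_le, pow_add, hx, zero_mul]
  rwa [sub_add_cancel, h2, zero_add, one_pow] at h

variable {Γ : Type u} [Group Γ]

/-- A quadratic element of a finite linear group in odd characteristic `p` centralises the abelian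
normal `p'`-subgroups. -/
theorem commute_of_quadratic_of_abelian [Finite Γ] (hp2 : p ≠ 2) (ρ : Γ →* E)
    (hρ : Function.Injective ρ) {y : Γ} (hy : (ρ y - 1) ^ 2 = 0) {B : Subgroup Γ} [hBn : B.Normal]
    (hB : ∀ a ∈ B, ∀ b ∈ B, a * b = b * a) (hcop : ¬ p ∣ Nat.card B) {a : Γ} (ha : a ∈ B) :
    y * a = a * y := by
  -- By Euler's theorem `b ^ q = b` on `B`. Since `x ↦ x ^ q` is additive on commuting elements, it
  -- fixes differences of elements of `ρ(B)` too, so such a difference is zero once its square is.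
  set q := p ^ (Nat.card B).totient with hq
  have hq2 : 2 ≤ q := by
    have : (Nat.card B).totient ≠ 0 := (Nat.totient_pos.mpr Nat.card_pos).ne'
    exact hp.out.two_le.trans (Nat.le_self_pow this p)
  have hfix : ∀ b ∈ B, ρ b ^ q = ρ b := by
    intro b hb
    rw [← map_pow]
    congr 1
    conv_rhs => rw [← pow_one b]
    rw [pow_eq_pow_iff_modEq]
    exact (Nat.ModEq.pow_totient ((Nat.Prime.coprime_iff_not_dvd hp.out).mpr hcop)).of_dvd
      (Subgroup.orderOf_dvd_natCard B hb)
  have hcomm : ∀ b ∈ B, ∀ c ∈ B, Commute (ρ b) (ρ c) := fun b hb c hc => by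
    rw [Commute, SemiconjBy, ← map_mul, ← map_mul, hB b hb c hc]
  have hsub : ∀ b ∈ B, ∀ c ∈ B, (ρ b - ρ c) ^ q = ρ b - ρ c := fun b hb c hc => by
    rw [hq, sub_pow_char_pow_of_commute p _ (hcomm b hb c hc), ← hq, hfix b hb, hfix c hc]
  have hnil : ∀ r : E, r ^ 2 = 0 → r ^ q = r → r = 0 := fun r h0 hr => by
    rw [← hr, ← Nat.add_sub_of_le hq2, pow_add, h0, zero_mul]
  set n := ρ y - 1 with hn
  have hn2 : n * n = 0 := by rw [← sq]; exact hy
  have hY : ρ y = 1 + n := by rw [hn]; abel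
  have hYi : ρ y⁻¹ = 1 - n := by
    have h1 : (1 - n) * ρ y = 1 := by rw [hY]; noncomm_ring; simp [hn2]
    calc ρ y⁻¹ = (1 - n) * ρ y * ρ y⁻¹ := by rw [h1, one_mul]
      _ = 1 - n := by rw [mul_assoc, ← map_mul, mul_inv_cancel, map_one, mul_one]
  have h1 : ∀ b, ρ (y * b * y⁻¹) = ρ b + n * ρ b - ρ b * n - n * ρ b * n := fun b => by
    rw [map_mul, map_mul, hY, hYi]; noncomm_ring
  have h2 : ∀ b, ρ (y⁻¹ * b * y) = ρ b - n * ρ b + ρ b * n - n * ρ b * n := fun b => by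
    rw [map_mul, map_mul, hY, hYi]; noncomm_ring
  have hm1 : ∀ b ∈ B, y * b * y⁻¹ ∈ B := fun b hb => hBn.conj_mem b hb y
  have hm2 : ∀ b ∈ B, y⁻¹ * b * y ∈ B := fun b hb => by simpa using hBn.conj_mem b hb y⁻¹
  -- Conjugating `b` by `y` and by `y⁻¹` gives two differences with sum `2 n b n`, whose square
  -- contains `n² = 0`.
  have key : ∀ b ∈ B, n * ρ b * n = 0 := by
    intro b hb
    apply eq_zero_of_two_mul_eq_zero_of_charP (p := p) hp2
    have e1 : (ρ b - ρ (y * b * y⁻¹)) + (ρ b - ρ (y⁻¹ * b * y)) = 2 * (n * ρ b * n) := by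
      rw [h1, h2]; noncomm_ring
    rw [← e1]
    apply hnil
    · rw [e1, sq]
      have : n * ρ b * n * (n * ρ b * n) = 0 := by
        rw [show n * ρ b * n * (n * ρ b * n) = n * ρ b * (n * n) * (ρ b * n) by noncomm_ring, hn2]
        simp
      rw [show 2 * (n * ρ b * n) * (2 * (n * ρ b * n)) =
        4 * (n * ρ b * n * (n * ρ b * n)) by noncomm_ring, this, mul_zero]
    · rw [hq, add_pow_char_pow_of_commute, ← hq, hsub b hb _ (hm1 b hb), hsub b hb _ (hm2 b hb)]
      exact ((hcomm b hb b hb).sub_right (hcomm b hb _ (hm2 b hb))).sub_left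
        ((hcomm _ (hm1 b hb) b hb).sub_right (hcomm _ (hm1 b hb) _ (hm2 b hb)))
  have k1 := key a ha
  have k2 : n * (ρ a * ρ a) * n = 0 := by rw [← map_mul]; exact key _ (B.mul_mem ha ha)
  -- This difference is `2 (n a - a n)`. Every term of its square contains `n a n`, `n a² n` or
  -- `n²`.
  have h3 : ρ (y * a * y⁻¹) - ρ (y⁻¹ * a * y) = 0 := by
    apply hnil
    · rw [h1, h2]
      have e : ρ a + n * ρ a - ρ a * n - n * ρ a * n - (ρ a - n * ρ a + ρ a * n - n * ρ a * n) =
        2 * (n * ρ a - ρ a * n) := by noncomm_ring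
      rw [e]
      have e2 : (2 * (n * ρ a - ρ a * n)) ^ 2 = 4 * (n * ρ a * n * ρ a + ρ a * (n * ρ a * n) -
        n * (ρ a * ρ a) * n - ρ a * (n * n) * ρ a) := by noncomm_ring
      rw [e2, k1, k2, hn2]
      simp
    · exact hsub _ (hm1 a ha) _ (hm2 a ha)
  rw [h1, h2] at h3
  have h4 : 2 * (n * ρ a - ρ a * n) = 0 := by rw [← h3]; noncomm_ring
  have h5 := eq_zero_of_two_mul_eq_zero_of_charP (p := p) hp2 h4
  apply hρ
  rw [map_mul, map_mul, hY]
  rw [sub_eq_zero] at h5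
  rw [add_mul, mul_add, h5, one_mul, mul_one]

/-- The elements `a + b n + c n' + d n n'` with coefficients in the double centraliser of
`n n' + n' n`, together with their conjugates `a - b n - c n' + d n' n`. -/
def IsQuaternionPair (n n' r r' : E) : Prop :=
  ∃ a ∈ Subring.centralizer (Set.centralizer {n * n' + n' * n}),
  ∃ b ∈ Subring.centralizer (Set.centralizer {n * n' + n' * n}),
  ∃ c ∈ Subring.centralizer (Set.centralizer {n * n' + n' * n}),
  ∃ d ∈ Subring.centralizer (Set.centralizer {n * n' + n' * n}),
    r = a + b * n + c * n' + d * (n * n') ∧ r' = a - b * n - c * n' + d * (n' * n)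

namespace IsQuaternionPair

variable {n n' r r' t t' : E}

theorem one : IsQuaternionPair n n' 1 1 :=
  ⟨1, one_mem _, 0, zero_mem _, 0, zero_mem _, 0, zero_mem _, by simp, by simp⟩

theorem neg (h : IsQuaternionPair n n' r r') : IsQuaternionPair n n' (-r) (-r') := by
  obtain ⟨a, ha, b, hb, c, hc, d, hd, rfl, rfl⟩ := h
  exact ⟨-a, neg_mem ha, -b, neg_mem hb, -c, neg_mem hc, -d, neg_mem hd,
    by noncomm_ring, by noncomm_ring⟩

theorem add (h : IsQuaternionPair n n' r r') (h' : IsQuaternionPair n n' t t') :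
    IsQuaternionPair n n' (r + t) (r' + t') := by
  obtain ⟨a, ha, b, hb, c, hc, d, hd, rfl, rfl⟩ := h
  obtain ⟨a', ha', b', hb', c', hc', d', hd', rfl, rfl⟩ := h'
  exact ⟨a + a', add_mem ha ha', b + b', add_mem hb hb', c + c', add_mem hc hc',
    d + d', add_mem hd hd', by noncomm_ring, by noncomm_ring⟩

/-- This is why the coefficients of a quaternion pair commute with `n` and `n'`. -/
theorem mem_centralizer_left (hn : n * n = 0) : n ∈ Set.centralizer {n * n' + n' * n} := by
  rw [Set.mem_centralizer_iff]
  rintro _ rfl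
  rw [add_mul, mul_add, mul_assoc n' n n, hn, ← mul_assoc n n n', hn]
  simp [mul_assoc]

theorem mem_centralizer_right (hn' : n' * n' = 0) :
    n' ∈ Set.centralizer {n * n' + n' * n} := by
  rw [add_comm]
  exact mem_centralizer_left hn'

/-- Passing from `r` to `r'` acts as an anti-involution sending `n` to `-n`. The span stays closed
because `n n' n = (n n' + n' n) n`. -/
theorem mul_left_aux (hn : n * n = 0) (h : IsQuaternionPair n n' r r') :
    IsQuaternionPair n n' (r * n) (-(n * r')) := by
  obtain ⟨a, ha, b, hb, c, hc, d, hd, rfl, rfl⟩ := h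
  have hs : n * n' + n' * n ∈ Subring.centralizer (Set.centralizer {n * n' + n' * n}) := by
    rw [Subring.mem_centralizer_iff]
    intro g hg
    exact ((Set.mem_centralizer_iff.mp hg) _ rfl).symm
  have hcn : ∀ x ∈ Subring.centralizer (Set.centralizer {n * n' + n' * n}), n * x = x * n :=
    fun x hx => Subring.mem_centralizer_iff.mp hx n (mem_centralizer_left hn)
  have h1 : n * n' * n = (n * n' + n' * n) * n := by
    rw [add_mul, mul_assoc n' n n, hn, mul_zero, add_zero]
  refine ⟨c * (n * n' + n' * n), mul_mem hc hs, a + d * (n * n' + n' * n),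
    add_mem ha (mul_mem hd hs), 0, zero_mem _, -c, neg_mem hc, ?_, ?_⟩
  · calc (a + b * n + c * n' + d * (n * n')) * n
        = a * n + b * (n * n) + c * (n' * n) + d * (n * n' * n) := by noncomm_ring
      _ = _ := by rw [h1, hn]; noncomm_ring
  · calc -(n * (a - b * n - c * n' + d * (n' * n)))
        = -(n * a) + (n * b) * n + (n * c) * n' - (n * d) * (n' * n) := by noncomm_ring
      _ = -(a * n) + b * (n * n) + c * (n * n') - d * (n * n' * n) := by
        rw [hcn a ha, hcn b hb, hcn c hc, hcn d hd]; noncomm_ring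
      _ = _ := by rw [h1, hn]; noncomm_ring

theorem mul_right_aux (hn' : n' * n' = 0) (h : IsQuaternionPair n n' r r') :
    IsQuaternionPair n n' (r * n') (-(n' * r')) := by
  obtain ⟨a, ha, b, hb, c, hc, d, hd, rfl, rfl⟩ := h
  have hcn : ∀ x ∈ Subring.centralizer (Set.centralizer {n * n' + n' * n}), n' * x = x * n' :=
    fun x hx => Subring.mem_centralizer_iff.mp hx n' (mem_centralizer_right hn')
  refine ⟨0, zero_mem _, 0, zero_mem _, a, ha, b, hb, ?_, ?_⟩
  · calc (a + b * n + c * n' + d * (n * n')) * n'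
        = a * n' + b * (n * n') + c * (n' * n') + d * n * (n' * n') := by noncomm_ring
      _ = _ := by rw [hn']; noncomm_ring
  · calc -(n' * (a - b * n - c * n' + d * (n' * n)))
        = -(n' * a) + (n' * b) * n + (n' * c) * n' - (n' * d) * (n' * n) := by noncomm_ring
      _ = -(a * n') + b * (n' * n) + c * (n' * n') - d * (n' * n' * n) := by
        rw [hcn a ha, hcn b hb, hcn c hc, hcn d hd]; noncomm_ring
      _ = _ := by rw [hn']; noncomm_ring

/-- The terms in `n` and `n'` cancel, leaving the trace `2a + d (n n' + n' n)`. -/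
theorem add_mem_centralizer (h : IsQuaternionPair n n' r r') :
    r + r' ∈ Subring.centralizer (Set.centralizer {n * n' + n' * n}) := by
  obtain ⟨a, ha, b, hb, c, hc, d, hd, rfl, rfl⟩ := h
  have hs : n * n' + n' * n ∈ Subring.centralizer (Set.centralizer {n * n' + n' * n}) := by
    rw [Subring.mem_centralizer_iff]
    intro g hg
    exact ((Set.mem_centralizer_iff.mp hg) _ rfl).symm
  rw [show a + b * n + c * n' + d * (n * n') + (a - b * n - c * n' + d * (n' * n)) =
    a + a + d * (n * n' + n' * n) by noncomm_ring]
  exact add_mem (add_mem ha ha) (mul_mem hd hs)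

end IsQuaternionPair

theorem map_inv_of_quadratic (ρ : Γ →* E) {y : Γ} (hy : (ρ y - 1) ^ 2 = 0) :
    ρ y⁻¹ = 1 - (ρ y - 1) := by
  have h1 : (1 - (ρ y - 1)) * ρ y = 1 := by
    have : (1 - (ρ y - 1)) * ρ y = 1 - (ρ y - 1) ^ 2 := by noncomm_ring
    rw [this, hy, sub_zero]
  calc ρ y⁻¹ = (1 - (ρ y - 1)) * ρ y * ρ y⁻¹ := by rw [h1, one_mul]
    _ = 1 - (ρ y - 1) := by rw [mul_assoc, ← map_mul, mul_inv_cancel, map_one, mul_one]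

/-- In the group generated by two quadratic elements `y` and `y'` all "traces" `g + g⁻¹` are
central. -/
theorem commute_add_inv_of_quadratic (ρ : Γ →* E) {y y' : Γ} (hy : (ρ y - 1) ^ 2 = 0)
    (hy' : (ρ y' - 1) ^ 2 = 0) {g : Γ} (hg : g ∈ Subgroup.closure {y, y'}) :
    ρ y' * (ρ g + ρ g⁻¹) = (ρ g + ρ g⁻¹) * ρ y' := by
  have hn : (ρ y - 1) * (ρ y - 1) = 0 := by rw [← sq, hy]
  have hn' : (ρ y' - 1) * (ρ y' - 1) = 0 := by rw [← sq, hy']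
  have hYi := map_inv_of_quadratic ρ hy
  have hYi' := map_inv_of_quadratic ρ hy'
  -- Inversion agrees with conjugation on the generators, where `ρ y = 1 + n` and `ρ y⁻¹ = 1 - n`,
  -- hence on all products.
  have key : IsQuaternionPair (ρ y - 1) (ρ y' - 1) (ρ g) (ρ g⁻¹) := by
    induction hg using Subgroup.closure_induction_right with
    | one => simpa using IsQuaternionPair.one
    | mul_right x hx z hz ih =>
      rcases hz with rfl | rfl
      · convert ih.add (ih.mul_left_aux hn) using 1
        · rw [map_mul]; noncomm_ring
        · rw [mul_inv_rev, map_mul, hYi]; noncomm_ring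
      · convert ih.add (ih.mul_right_aux hn') using 1
        · rw [map_mul]; noncomm_ring
        · rw [mul_inv_rev, map_mul, hYi']; noncomm_ring
    | mul_inv_cancel x hx z hz ih =>
      rcases hz with rfl | rfl
      · convert ih.add (ih.mul_left_aux hn).neg using 1
        · rw [map_mul, hYi]; noncomm_ring
        · rw [mul_inv_rev, inv_inv, map_mul]; noncomm_ring
      · convert ih.add (ih.mul_right_aux hn').neg using 1
        · rw [map_mul, hYi']; noncomm_ring
        · rw [mul_inv_rev, inv_inv, map_mul]; noncomm_ring
  have := Subring.mem_centralizer_iff.mp key.add_mem_centralizer (ρ y' - 1)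
    (IsQuaternionPair.mem_centralizer_right hn')
  rw [sub_mul, mul_sub, one_mul, mul_one] at this
  exact sub_left_injective this

end Quadratic

/-! ### Derived series and transfer. -/

/-- If a solvable normal subgroup `U` is not contained in `N`, some term `D` of its derived
series is not contained in `N` while its derived subgroup is. -/
theorem exists_normal_commutator_le {G : Type u} [Group G] {U N : Subgroup G} [U.Normal]
    [Group.IsSolvable U] (h : ¬ U ≤ N) :
    ∃ D : Subgroup G, D.Normal ∧ D ≤ U ∧ ¬ D ≤ N ∧ ⁅D, D⁆ ≤ N ∧ (D = U ∨ D ≤ ⁅U, U⁆) := by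
  let f : ℕ → Subgroup G := fun n => (derivedSeries U n).map U.subtype
  have h0 : f 0 = U := by simp [f, ← MonoidHom.range_eq_map]
  have hsucc : ∀ n, f (n + 1) = ⁅f n, f n⁆ := fun n => by
    simp [f, derivedSeries_succ, Subgroup.map_commutator]
  have hle : ∀ n, f n ≤ U := fun n => Subgroup.map_subtype_le _
  have hnormal : ∀ n, (f n).Normal := by
    intro n
    induction n with
    | zero => rwa [h0]
    | succ n ih => rw [hsucc]; infer_instance
  have hex : ∃ n, f n ≤ N := by
    obtain ⟨n, hn⟩ := Group.IsSolvable.solvable (G := U)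
    exact ⟨n, by simp [f, hn]⟩
  classical
  obtain ⟨m, hm⟩ : ∃ m, Nat.find hex = m + 1 := by
    refine Nat.exists_eq_succ_of_ne_zero fun h' => h ?_
    have := Nat.find_spec hex
    rwa [h', h0] at this
  refine ⟨f m, hnormal m, hle m, Nat.find_min hex (by omega), ?_, ?_⟩
  · rw [← hsucc, ← hm]
    exact Nat.find_spec hex
  · rcases m with _ | m
    · exact Or.inl h0
    · right
      rw [hsucc]
      exact Subgroup.commutator_mono (hle m) (hle m)

/-- If the Sylow `p`-subgroups are abelian, a central element of the derived subgroup has order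
prime to `p`. -/
theorem eq_one_of_mem_center_of_mem_commutator {G : Type u} [Group G] [Finite G] {p : ℕ}
    [hp : Fact p.Prime] (P : Sylow p G) (hP : ∀ a ∈ P, ∀ b ∈ P, a * b = b * a) {z : G}
    (hz : z ∈ Subgroup.center G) (hz' : z ∈ commutator G) (hzp : z ^ p = 1) : z = 1 := by
  let _ : CommGroup P :=
    { (inferInstance : Group P) with
      mul_comm := fun a b => Subtype.ext (hP a a.2 b b.2) }
  have h1 : ∀ (k : ℕ) (g : G), g⁻¹ * z ^ k * g ∈ (P : Subgroup G) → g⁻¹ * z ^ k * g = z ^ k :=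
    fun k g _ => by
      rw [mul_assoc, ← Subgroup.mem_center_iff.mp (Subgroup.pow_mem _ hz k) g,
        inv_mul_cancel_left]
  -- The transfer into the abelian group `P` sends the central `z` to `z ^ |G : P|`, yet it kills
  -- the derived subgroup.
  have h2 := MonoidHom.transfer_eq_pow (H := (P : Subgroup G)) (MonoidHom.id P) z h1
  have h3 : MonoidHom.transfer (MonoidHom.id P) z = 1 := Abelianization.commutator_subset_ker _ hz'
  rw [h3] at h2
  have h4 : z ^ (P : Subgroup G).index = 1 := (congrArg Subtype.val h2).symm
  have h5 : p.Coprime (P : Subgroup G).index :=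
    (Nat.Prime.coprime_iff_not_dvd hp.out).mpr P.not_dvd_index
  rw [← orderOf_eq_one_iff, ← Nat.dvd_one, ← h5]
  exact Nat.dvd_gcd (orderOf_dvd_of_pow_eq_one hzp) (orderOf_dvd_of_pow_eq_one h4)

theorem eq_one_of_pow_eq_one_of_coprime {G : Type u} [Group G] {g : G} {m n : ℕ}
    (hmn : m.Coprime n) (hm : g ^ m = 1) (hn : g ^ n = 1) : g = 1 := by
  rw [← orderOf_eq_one_iff, ← Nat.dvd_one, ← hmn]
  exact Nat.dvd_gcd (orderOf_dvd_of_pow_eq_one hm) (orderOf_dvd_of_pow_eq_one hn)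

theorem pow_card_eq_one_of_mem {G : Type u} [Group G] {U : Subgroup G} {g : G} (hg : g ∈ U) :
    g ^ Nat.card U = 1 := by
  have := pow_card_eq_one' (x := (⟨g, hg⟩ : U))
  exact congrArg Subtype.val this

/-! ### Quadratic elements in solvable linear groups. -/

section Quadratic

variable {E : Type v} [Ring E] {p : ℕ} [hp : Fact p.Prime] [CharP E p]
variable {Γ : Type u} [Group Γ]

/-- If `y` and `y'` are quadratic and generate `Γ`, a central element of the normal
`p'`-subgroup generated by `y y'⁻¹` squares to one. -/
theorem sq_eq_one_of_central_of_quadratic (ρ : Γ →* E) (hρ : Function.Injective ρ)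
    {y y' : Γ} (hy : (ρ y - 1) ^ 2 = 0) (hy' : (ρ y' - 1) ^ 2 = 0)
    (hgen : Subgroup.closure {y, y'} = ⊤)
    (hcop : ¬ p ∣ Nat.card (Subgroup.normalClosure {y * y'⁻¹})) {ζ : Γ}
    (hζ : ζ ∈ Subgroup.center Γ) (hζU : ζ ∈ Subgroup.normalClosure {y * y'⁻¹}) :
    ζ ^ 2 = 1 := by
  have hζc : ∀ g, g * ζ = ζ * g := Subgroup.mem_center_iff.mp hζ
  have hcop' : p.Coprime (Nat.card (Subgroup.normalClosure {y * y'⁻¹})) :=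
    (Nat.Prime.coprime_iff_not_dvd hp.out).mpr hcop
  have hyp : y ^ p = 1 := hρ (by rw [map_pow, pow_char_eq_one_of_sq_eq_zero p hy, map_one])
  have hyp' : y' ^ p = 1 := hρ (by rw [map_pow, pow_char_eq_one_of_sq_eq_zero p hy', map_one])
  -- The aim is `e² = 0`: then `ζ²` has order dividing `p` inside a `p'`-group.
  set e : E := ρ (ζ ^ 2) - 1 with he
  have hec : ∀ g, ρ g * e = e * ρ g := fun g => by
    rw [he, mul_sub, sub_mul, ← map_mul, ← map_mul, mul_one, one_mul, sq, ← mul_assoc, hζc,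
      mul_assoc, hζc]
  -- The trace of `ζ y` commutes with `y'`. Since `ρ y⁻¹ = 2 - ρ y`, this says that `ζ - ζ⁻¹`
  -- annihilates `y y' - y' y`.
  have hke : (ρ y * ρ y' - ρ y' * ρ y) * e = 0 := by
    have h1 := commute_add_inv_of_quadratic ρ hy hy' (g := ζ * y) (hgen ▸ Subgroup.mem_top _)
    rw [mul_inv_rev, map_mul, map_mul, map_inv_of_quadratic ρ hy] at h1
    have hc : ρ y' * ρ ζ = ρ ζ * ρ y' := by rw [← map_mul, hζc, map_mul]
    have hc' : ρ y' * ρ ζ⁻¹ = ρ ζ⁻¹ * ρ y' := by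
      rw [← map_mul, ← map_mul]
      congr 1
      rw [mul_inv_eq_iff_eq_mul, mul_assoc, hζc, inv_mul_cancel_left]
    have hci : ρ ζ * ρ ζ⁻¹ = 1 := by rw [← map_mul, mul_inv_cancel, map_one]
    have h2 : (ρ ζ - ρ ζ⁻¹) * (ρ y * ρ y' - ρ y' * ρ y) = 0 := by
      have h3 : (1 - (ρ y - 1)) * ρ ζ⁻¹ = ρ ζ⁻¹ * (1 - (ρ y - 1)) := by
        have : ρ y * ρ ζ⁻¹ = ρ ζ⁻¹ * ρ y := by
          rw [← map_mul, ← map_mul]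
          congr 1
          rw [mul_inv_eq_iff_eq_mul, mul_assoc, hζc, inv_mul_cancel_left]
        rw [mul_sub, sub_mul, mul_sub, sub_mul, this]
        simp
      rw [h3, mul_add, ← mul_assoc, ← mul_assoc, hc, hc'] at h1
      rw [← sub_eq_zero] at h1
      rw [← neg_eq_zero, ← h1]
      noncomm_ring
    have h5 : (ρ y * ρ y' - ρ y' * ρ y) * e = e * (ρ y * ρ y' - ρ y' * ρ y) := by
      rw [← map_mul, ← map_mul, sub_mul, hec, hec, mul_sub]
    rw [h5]
    have h4 : e = ρ ζ * (ρ ζ - ρ ζ⁻¹) := by rw [mul_sub, hci, he, sq, map_mul]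
    rw [h4, mul_assoc, h2, mul_zero]
  -- Modulo `T` the elements `y` and `y'` commute, so `y y'⁻¹` has order dividing `p` there, and
  -- also prime to `p`. Hence `T` contains its normal closure, in particular `ζ`.
  let T : Subgroup Γ :=
    { carrier := {g | ρ g * e = e}
      one_mem' := by simp
      mul_mem' := fun {a b} ha hb => by
        rw [Set.mem_ofPred_eq] at ha hb ⊢
        rw [map_mul, mul_assoc, hb, ha]
      inv_mem' := fun {a} ha => by
        rw [Set.mem_ofPred_eq] at ha ⊢
        conv_lhs => rw [← ha]
        rw [← mul_assoc, ← map_mul, inv_mul_cancel, map_one, one_mul] }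
  have hT : ∀ g, g ∈ T ↔ ρ g * e = e := fun _ => Iff.rfl
  have hTn : T.Normal := ⟨fun a ha g => by
    rw [hT] at ha ⊢
    rw [map_mul, map_mul, mul_assoc, hec, ← mul_assoc, mul_assoc (ρ g), ha, hec, mul_assoc,
      ← map_mul, mul_inv_cancel, map_one, mul_one]⟩
  have hcommT : ((y : Γ ⧸ T) * (y' : Γ ⧸ T)) = y' * y := by
    rw [← QuotientGroup.mk_mul, ← QuotientGroup.mk_mul, QuotientGroup.eq, hT]
    have h1 : ρ (y * y') * e = ρ (y' * y) * e := by
      rw [← sub_eq_zero, ← sub_mul, map_mul, map_mul, hke]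
    rw [map_mul, mul_assoc, ← h1, ← mul_assoc, ← map_mul, inv_mul_cancel, map_one, one_mul]
  have huT : y * y'⁻¹ ∈ T := by
    rw [← QuotientGroup.eq_one_iff]
    refine eq_one_of_pow_eq_one_of_coprime hcop' ?_ ?_
    · have hc : Commute (y : Γ ⧸ T) (y' : Γ ⧸ T)⁻¹ := Commute.inv_right hcommT
      rw [QuotientGroup.mk_mul, QuotientGroup.mk_inv, hc.mul_pow, inv_pow,
        ← QuotientGroup.mk_pow, ← QuotientGroup.mk_pow, hyp, hyp']
      simp
    · rw [← QuotientGroup.mk_pow, pow_card_eq_one_of_mem (U := Subgroup.normalClosure {y * y'⁻¹}),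
        QuotientGroup.mk_one]
      exact Subgroup.subset_normalClosure rfl
  have hζT : ρ ζ * e = e :=
    Subgroup.normalClosure_le_normal (Set.singleton_subset_iff.mpr huT) hζU
  have hee : (ρ (ζ ^ 2) - 1) ^ 2 = 0 := by
    rw [sq, ← he]
    have h1 : ρ (ζ ^ 2) * e = e := by rw [sq, map_mul, mul_assoc, hζT, hζT]
    conv_lhs => enter [1]; rw [he]
    rw [sub_mul, h1, one_mul, sub_self]
  have hp1 : (ζ ^ 2) ^ p = 1 :=
    hρ (by rw [map_pow, pow_char_eq_one_of_sq_eq_zero p hee, map_one])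
  exact eq_one_of_pow_eq_one_of_coprime hcop' hp1
    (pow_card_eq_one_of_mem (Subgroup.pow_mem _ hζU 2))

/-- Otherwise the last nontrivial derived term `B` of the normal closure `U` of `y y'⁻¹` is central
by the abelian case. If `B = U`, then `y y'⁻¹` is central of order dividing `p` in a `p'`-group. If
`B ≤ [U, U]`, its elements square to one, and transfer to an abelian Sylow `2`-subgroup of `U` kills
them. -/
theorem eq_of_quadratic_of_closure_eq_top [Finite Γ] [Group.IsSolvable Γ] (hp2 : p ≠ 2) (ρ : Γ →* E)
    (hρ : Function.Injective ρ) {y y' : Γ} (hy : (ρ y - 1) ^ 2 = 0)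
    (hy' : (ρ y' - 1) ^ 2 = 0) (hgen : Subgroup.closure {y, y'} = ⊤)
    (hcop : ¬ p ∣ Nat.card (Subgroup.normalClosure {y * y'⁻¹}))
    (h2 : ∀ T ≤ Subgroup.normalClosure {y * y'⁻¹}, IsPGroup 2 T →
      ∀ a ∈ T, ∀ b ∈ T, a * b = b * a) : y = y' := by
  set U := Subgroup.normalClosure {y * y'⁻¹} with hU
  have huU : y * y'⁻¹ ∈ U := Subgroup.subset_normalClosure rfl
  have hcop' : p.Coprime (Nat.card U) := (Nat.Prime.coprime_iff_not_dvd hp.out).mpr hcop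
  by_contra hne
  have hUbot : ¬ U ≤ ⊥ := fun h => hne (mul_inv_eq_one.mp (h huU))
  obtain ⟨B, hBn, hBU, hBbot, hBB, hBcases⟩ := exists_normal_commutator_le hUbot
  have hBcomm : ∀ a ∈ B, ∀ b ∈ B, a * b = b * a := fun a ha b hb =>
    commutatorElement_eq_one_iff_mul_comm.mp (hBB (Subgroup.commutator_mem_commutator ha hb))
  have hBcop : ¬ p ∣ Nat.card B := fun h => hcop (h.trans (Subgroup.card_dvd_of_le hBU))
  have hBcenter : ∀ b ∈ B, b ∈ Subgroup.center Γ := by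
    intro b hb
    have hle : Subgroup.closure {y, y'} ≤ Subgroup.centralizer {b} := by
      rw [Subgroup.closure_le]
      rintro _ (rfl | rfl)
      · exact Subgroup.mem_centralizer_singleton_iff.mpr
          (commute_of_quadratic_of_abelian hp2 ρ hρ hy hBcomm hBcop hb)
      · exact Subgroup.mem_centralizer_singleton_iff.mpr
          (commute_of_quadratic_of_abelian hp2 ρ hρ hy' hBcomm hBcop hb)
    rw [Subgroup.mem_center_iff]
    intro g
    exact Subgroup.mem_centralizer_singleton_iff.mp (hle (hgen ▸ Subgroup.mem_top g))
  rcases hBcases with rfl | hBle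
  · have huc := Subgroup.mem_center_iff.mp (hBcenter _ huU)
    have hyp : y ^ p = 1 := hρ (by rw [map_pow, pow_char_eq_one_of_sq_eq_zero p hy, map_one])
    have hyp' : y' ^ p = 1 :=
      hρ (by rw [map_pow, pow_char_eq_one_of_sq_eq_zero p hy', map_one])
    have hup : (y * y'⁻¹) ^ p = 1 := by
      have hc : Commute (y * y'⁻¹) y' := (huc y').symm
      have := hc.mul_pow p
      rwa [inv_mul_cancel_right, hyp, hyp', mul_one, eq_comm] at this
    exact hne (mul_inv_eq_one.mp
      (eq_one_of_pow_eq_one_of_coprime hcop' hup (pow_card_eq_one_of_mem huU)))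
  · obtain ⟨ζ, hζB, hζ1⟩ : ∃ ζ ∈ B, ζ ≠ 1 := by
      by_contra! h
      exact hBbot fun b hb => h b hb
    have hζ2 := sq_eq_one_of_central_of_quadratic ρ hρ hy hy' hgen hcop (hBcenter ζ hζB)
      (hBU hζB)
    let S : Sylow 2 U := default
    have hS := h2 ((S : Subgroup U).map U.subtype) (Subgroup.map_subtype_le _)
      (S.isPGroup'.map _)
    have := eq_one_of_mem_center_of_mem_commutator S
      (fun a ha b hb => Subtype.ext (hS a ⟨a, ha, rfl⟩ b ⟨b, hb, rfl⟩))
      (z := (⟨ζ, hBU hζB⟩ : U))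
      (Subgroup.mem_center_iff.mpr fun g =>
        Subtype.ext (Subgroup.mem_center_iff.mp (hBcenter ζ hζB) g))
      (by
        have h1 := hBle hζB
        have hmap : (commutator U).map U.subtype = ⁅U, U⁆ := by
          simp [commutator_def, Subgroup.map_commutator, ← MonoidHom.range_eq_map]
        rw [← hmap] at h1
        obtain ⟨x, hx, hxζ⟩ := h1
        rwa [← show x = ⟨ζ, hBU hζB⟩ from Subtype.ext hxζ])
      (Subtype.ext hζ2)
    exact hζ1 (congrArg Subtype.val this)

/-- In a finite solvable linear group in odd characteristic `p`, quadratic elements centralise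
the normal `p'`-subgroups with abelian Sylow `2`-subgroups. -/
theorem commute_of_quadratic [Finite Γ] [Group.IsSolvable Γ] (hp2 : p ≠ 2) (ρ : Γ →* E)
    (hρ : Function.Injective ρ) {y : Γ} (hy : (ρ y - 1) ^ 2 = 0) {K : Subgroup Γ}
    [hK : K.Normal] (hcop : ¬ p ∣ Nat.card K)
    (h2 : ∀ T ≤ K, IsPGroup 2 T → ∀ a ∈ T, ∀ b ∈ T, a * b = b * a) {k : Γ} (hk : k ∈ K) :
    y * k = k * y := by
  -- The claim is `y = y'`. Here `y y'⁻¹ = [y, k]` lies in `K`, so its normal closure in `⟨y, y'⟩`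
  -- is a `p'`-group.
  set y' := k * y * k⁻¹ with hy'
  have hyy : y * y'⁻¹ ∈ K := by
    rw [hy', show y * (k * y * k⁻¹)⁻¹ = (y * k * y⁻¹) * k⁻¹ by group]
    exact K.mul_mem (hK.conj_mem k hk y) (K.inv_mem hk)
  let Δ := Subgroup.closure {y, y'}
  let w : Δ := ⟨y, Subgroup.subset_closure (Or.inl rfl)⟩
  let w' : Δ := ⟨y', Subgroup.subset_closure (Or.inr rfl)⟩
  have hle : Subgroup.normalClosure {w * w'⁻¹} ≤ K.subgroupOf Δ :=
    Subgroup.normalClosure_le_normal (Set.singleton_subset_iff.mpr hyy)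
  have hquad : (ρ y' - 1) ^ 2 = 0 := by
    have hk1 : ρ k⁻¹ * ρ k = 1 := by rw [← map_mul, inv_mul_cancel, map_one]
    have hk2 : ρ k * ρ k⁻¹ = 1 := by rw [← map_mul, mul_inv_cancel, map_one]
    have h1 : ρ y' - 1 = ρ k * (ρ y - 1) * ρ k⁻¹ := by
      rw [hy', map_mul, map_mul, mul_sub, sub_mul, mul_one, hk2]
    rw [h1, sq, show ρ k * (ρ y - 1) * ρ k⁻¹ * (ρ k * (ρ y - 1) * ρ k⁻¹) =
      ρ k * (ρ y - 1) * (ρ k⁻¹ * ρ k) * (ρ y - 1) * ρ k⁻¹ by simp only [mul_assoc], hk1, mul_one,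
      mul_assoc (ρ k), ← sq, hy, mul_zero, zero_mul]
  have hgen : Subgroup.closure {w, w'} = ⊤ := by
    have := Subgroup.closure_closure_coe_preimage (k := ({y, y'} : Set Γ))
    convert this using 2
    ext x
    simp [w, w', Subtype.ext_iff]
  have := eq_of_quadratic_of_closure_eq_top hp2 (ρ.comp Δ.subtype)
    (hρ.comp Subtype.val_injective) (y := w) (y' := w') hy hquad hgen
    (fun h => hcop (h.trans ((Subgroup.card_dvd_of_le hle).trans ?_)))
    (fun T hT hT2 a ha b hb => ?_)
  · have h3 : y = k * y * k⁻¹ := congrArg Subtype.val this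
    conv_lhs => rw [h3]
    rw [inv_mul_cancel_right]
  · have : (K.subgroupOf Δ).map Δ.subtype ≤ K := by
      rw [Subgroup.subgroupOf_map_subtype]; exact inf_le_left
    rw [← Subgroup.card_map_of_injective (f := Δ.subtype) Subtype.val_injective]
    exact Subgroup.card_dvd_of_le this
  · refine Subtype.ext (h2 (T.map Δ.subtype) ?_ (hT2.map _) a ⟨a, ha, rfl⟩ b ⟨b, hb, rfl⟩)
    rintro _ ⟨x, hx, rfl⟩
    exact hle (hT hx)

end Quadratic

/-! ### Largest normal `π`-subgroups and their centralisers. -/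

/-- All prime divisors of `n` satisfy `π`. -/
def PrimesIn (π : ℕ → Prop) (n : ℕ) : Prop := ∀ r, r.Prime → r ∣ n → π r

theorem primesIn_ne_iff {p n : ℕ} (hp : p.Prime) : PrimesIn (· ≠ p) n ↔ ¬ p ∣ n :=
  ⟨fun h hn => h p hp hn rfl, fun h _ _ hr e => h (e ▸ hr)⟩

theorem primesIn_eq_iff {p : ℕ} [hp : Fact p.Prime] {G : Type u} [Group G] [Finite G] :
    PrimesIn (· = p) (Nat.card G) ↔ IsPGroup p G := by
  constructor
  · exact fun h => IsPGroup.of_card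
      (Nat.eq_prime_pow_of_unique_prime_dvd Nat.card_pos.ne' fun {d} hd hdn => h d hd hdn)
  · intro h r hr hrd
    obtain ⟨n, hn⟩ := IsPGroup.iff_card.mp h
    rw [hn] at hrd
    exact (Nat.prime_dvd_prime_iff_eq hr hp.out).mp (hr.dvd_of_dvd_pow hrd)

section

variable {G : Type u} [Group G] [Finite G]

/-- The largest normal `π`-subgroup. -/
theorem exists_characteristic_primesIn (π : ℕ → Prop) (G : Type u) [Group G] [Finite G] :
    ∃ K : Subgroup G, K.Characteristic ∧ PrimesIn π (Nat.card K) ∧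
      ∀ L : Subgroup G, L.Normal → PrimesIn π (Nat.card L) → L ≤ K := by
  let S := {L : Subgroup G // L.Normal ∧ PrimesIn π (Nat.card L)}
  have : Nonempty S := ⟨⟨⊥, inferInstance, fun r hr h => by
    rw [Subgroup.card_bot, Nat.dvd_one] at h
    exact absurd h hr.ne_one⟩⟩
  obtain ⟨⟨K, hKn, hK⟩, hmax⟩ := Finite.exists_max fun L : S => Nat.card L.1
  have hle : ∀ L : Subgroup G, L.Normal → PrimesIn π (Nat.card L) → L ≤ K := by
    intro L hLn hL
    have hsup : PrimesIn π (Nat.card (K ⊔ L : Subgroup G)) := by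
      intro r hr hrd
      have h1 : Nat.card (K ⊔ L : Subgroup G) = Nat.card K * K.relIndex L := by
        have h2 := Subgroup.card_mul_index (K.subgroupOf (K ⊔ L))
        rw [← h2, ← Subgroup.relIndex, Subgroup.relIndex_sup_left]
        congr 1
        exact Nat.card_congr (Subgroup.subgroupOfEquivOfLe le_sup_left).toEquiv
      rw [h1, hr.dvd_mul] at hrd
      rcases hrd with h | h
      · exact hK r hr h
      · exact hL r hr (h.trans (Subgroup.relIndex_dvd_card _ _))
    have := Subgroup.eq_of_le_of_card_ge (le_sup_left : K ≤ K ⊔ L)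
      (hmax ⟨K ⊔ L, inferInstance, hsup⟩)
    rw [this]
    exact le_sup_right
  refine ⟨K, ?_, hK, hle⟩
  rw [Subgroup.characteristic_iff_map_le]
  intro φ
  refine hle _ (hKn.map _ φ.surjective) ?_
  rwa [Subgroup.card_map_of_injective φ.injective]

/-- Sylow subgroups of the nilpotent group `D` are characteristic in `D`, hence normal in `G`. -/
theorem primesIn_card_of_isNilpotent {π : ℕ → Prop}
    (h : ∀ r, r.Prime → ¬ π r → ∀ R : Subgroup G, R.Normal → IsPGroup r R → R = ⊥)
    {D : Subgroup G} [D.Normal] [Group.IsNilpotent D] : PrimesIn π (Nat.card D) := by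
  intro r hr hrd
  by_contra hπ
  have : Fact r.Prime := ⟨hr⟩
  let S : Sylow r D := default
  have : (S : Subgroup D).Characteristic := S.characteristic_of_normal inferInstance
  have h1 := h r hr hπ ((S : Subgroup D).map D.subtype) inferInstance (S.isPGroup'.map _)
  rw [Subgroup.map_eq_bot_iff_of_injective _ D.subtype_injective] at h1
  exact S.ne_bot_of_dvd_card hrd h1

/-- In a finite solvable group without nontrivial normal `r`-subgroups for `r ∉ π`, the largest
normal `π`-subgroup contains its centraliser. -/
theorem centralizer_le_of_forall_primesIn_le [Group.IsSolvable G] {π : ℕ → Prop}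
    (h : ∀ r, r.Prime → ¬ π r → ∀ R : Subgroup G, R.Normal → IsPGroup r R → R = ⊥)
    {N : Subgroup G} [N.Normal]
    (hN : ∀ L : Subgroup G, L.Normal → PrimesIn π (Nat.card L) → L ≤ N) :
    Subgroup.centralizer (N : Set G) ≤ N := by
  by_contra hC
  obtain ⟨D, hDn, hDC, hDN, hDD, -⟩ := exists_normal_commutator_le hC
  -- The derived subgroup of `D` lies in `N`, which `D` centralises.
  have : Group.IsNilpotent D := by
    refine Subgroup.isNilpotent_of_ker_le_center (Abelianization.of (G := D)) ?_
    rw [Abelianization.ker_of]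
    intro x hx
    rw [Subgroup.mem_center_iff]
    intro d
    have hxN : (x : G) ∈ N := by
      refine hDD ?_
      have hmap : (commutator D).map D.subtype = ⁅D, D⁆ := by
        simp [commutator_def, Subgroup.map_commutator, ← MonoidHom.range_eq_map]
      rw [← hmap]
      exact ⟨x, hx, rfl⟩
    exact Subtype.ext (Subgroup.mem_centralizer_iff.mp (hDC d.2) x hxN).symm
  exact hDN (hN D hDn (primesIn_card_of_isNilpotent h))

/-- A version of `Sylow.mapSurjective_surjective` for subgroups. -/
theorem exists_isPGroup_le_map {G' : Type v} [Group G'] {p : ℕ} [Fact p.Prime] (f : G →* G')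
    {K : Subgroup G} {T : Subgroup G'} (hT : IsPGroup p T) (hTK : T ≤ K.map f) :
    ∃ S ≤ K, IsPGroup p S ∧ T ≤ S.map f := by
  have hf : Function.Surjective (f.subgroupMap K) := f.subgroupMap_surjective K
  have : Finite (K.map f) := Finite.of_surjective _ hf
  obtain ⟨Q, hQ⟩ := (hT.comap_subtype (K := K.map f)).exists_le_sylow
  obtain ⟨S, rfl⟩ := Sylow.mapSurjective_surjective hf p Q
  refine ⟨(S : Subgroup K).map K.subtype, Subgroup.map_subtype_le _, S.isPGroup'.map _, ?_⟩
  intro t ht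
  obtain ⟨x, hx, hxt⟩ := hQ (x := ⟨t, hTK ht⟩) ht
  exact ⟨x, ⟨x, hx, rfl⟩, congrArg Subtype.val hxt⟩

end

/-! ### The Frattini quotient of a `p`-group. -/

section Frattini

variable {N : Type u} [Group N] [Finite N] {p : ℕ} [hp : Fact p.Prime]

/-- A maximal subgroup of a nilpotent group is normal. By maximality any element of order `p`
generates the quotient, which is thus cyclic of order `p`. -/
theorem IsPGroup.quotient_coatom (hN : IsPGroup p N) {X : Subgroup N} (hX : IsCoatom X)
    (a b : N) : ⁅a, b⁆ ∈ X ∧ a ^ p ∈ X := by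
  have hnil : Group.IsNilpotent N := hN.isNilpotent
  have hXn : X.Normal :=
    Subgroup.NormalizerCondition.normal_of_coatom X Group.normalizerCondition_of_isNilpotent hX
  have hQ : IsPGroup p (N ⧸ X) := hN.to_quotient X
  have hQ1 : Nat.card (N ⧸ X) ≠ 1 := by
    rw [← Subgroup.index_eq_card, Ne, Subgroup.index_eq_one]
    exact hX.1
  obtain ⟨c, hc⟩ := exists_prime_orderOf_dvd_card' p ((hQ.card_eq_or_dvd).resolve_left hQ1)
  have htop : Subgroup.zpowers c = ⊤ := by
    have hle : X < (Subgroup.zpowers c).comap (QuotientGroup.mk' X) := by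
      refine lt_of_le_of_ne ?_ fun h => ?_
      · intro x hx
        rw [Subgroup.mem_comap, QuotientGroup.mk'_apply, (QuotientGroup.eq_one_iff x).mpr hx]
        exact one_mem _
      · obtain ⟨d, rfl⟩ := QuotientGroup.mk_surjective c
        have hd : d ∈ X := by
          rw [h]
          exact Subgroup.mem_zpowers _
        rw [(QuotientGroup.eq_one_iff d).mpr hd, orderOf_one] at hc
        exact hp.out.ne_one hc.symm
    have := hX.2 _ hle
    rwa [← Subgroup.comap_top (QuotientGroup.mk' X),
      (Subgroup.comap_injective (QuotientGroup.mk'_surjective X)).eq_iff] at this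
  have hpow : ∀ x : N ⧸ X, ∃ k : ℤ, c ^ k = x := fun x =>
    Subgroup.mem_zpowers_iff.mp (htop ▸ Subgroup.mem_top x)
  obtain ⟨i, hi⟩ := hpow a
  obtain ⟨j, hj⟩ := hpow b
  constructor
  · rw [← QuotientGroup.eq_one_iff, ← QuotientGroup.mk'_apply, map_commutatorElement,
      QuotientGroup.mk'_apply, QuotientGroup.mk'_apply, ← hi, ← hj,
      commutatorElement_eq_one_iff_mul_comm, ← zpow_add, ← zpow_add, add_comm]
  · rw [← QuotientGroup.eq_one_iff, QuotientGroup.mk_pow, ← hi, ← zpow_natCast, ← zpow_mul,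
      mul_comm, zpow_mul, zpow_natCast, ← hc, pow_orderOf_eq_one, one_zpow]

theorem IsPGroup.commutator_mem_frattini (hN : IsPGroup p N) (a b : N) :
    ⁅a, b⁆ ∈ frattini N := by
  simp only [frattini, Order.radical, Subgroup.mem_iInf]
  exact fun X hX => (hN.quotient_coatom hX a b).1

theorem IsPGroup.pow_mem_frattini (hN : IsPGroup p N) (a : N) : a ^ p ∈ frattini N := by
  simp only [frattini, Order.radical, Subgroup.mem_iInf]
  exact fun X hX => (hN.quotient_coatom hX a 1).2

/-- An automorphism of prime order `r ≠ p` of a finite `p`-group that is trivial modulo the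
Frattini subgroup is trivial. -/
theorem IsPGroup.eq_self_of_frattini (hN : IsPGroup p N) {r : ℕ} [hr : Fact r.Prime] (hrp : r ≠ p)
    {α : MulAut N} (hα : α ^ r = 1) (h : ∀ n, n⁻¹ * α n ∈ frattini N) (n : N) : α n = n := by
  let C : Subgroup N := α.toMonoidHom.eqLocus (MonoidHom.id N)
  have hC : ∀ x, x ∈ C ↔ α x = x := fun _ => Iff.rfl
  suffices hsup : C ⊔ frattini N = ⊤ by
    rw [← hC, frattini_nongenerating hsup]
    exact Subgroup.mem_top n
  rw [eq_top_iff]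
  intro m _
  -- The map `α` permutes this coset, whose size is prime to `r`, so it fixes a point of it. Thus
  -- fixed points generate `N` modulo the Frattini subgroup, hence `N` itself.
  let X := {x : N // m⁻¹ * x ∈ frattini N}
  have hmem : ∀ x : N, m⁻¹ * α x ∈ frattini N ↔ m⁻¹ * x ∈ frattini N := fun x => by
    rw [← mul_inv_cancel_left x (α x), ← mul_assoc]
    exact Subgroup.mul_mem_cancel_right _ (h x)
  let σ : Equiv.Perm X := α.toEquiv.subtypeEquiv fun x => (hmem x).symm
  have hσ : ∀ k : ℕ, ∀ x : X, ((σ ^ k) x : N) = (α ^ k) x := by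
    intro k
    induction k with
    | zero => intro x; simp
    | succ k ih =>
      intro x
      rw [pow_succ', pow_succ', Equiv.Perm.mul_apply, MulAut.mul_apply, ← ih]
      rfl
  have hσr : σ ^ r ^ 1 = 1 := by
    ext x
    rw [pow_one, hσ, hα]
    rfl
  have hcard : Nat.card X = Nat.card (frattini N) := by
    refine Nat.card_congr ⟨fun x => ⟨m⁻¹ * x, x.2⟩, fun y => ⟨m * y, by simp⟩,
      fun x => by simp, fun y => by simp⟩
  have hrX : ¬ r ∣ Nat.card X := by
    rw [hcard]
    obtain ⟨k, hk⟩ := IsPGroup.iff_card.mp (hN.to_subgroup (frattini N))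
    rw [hk]
    exact fun hd => hrp ((Nat.prime_dvd_prime_iff_eq hr.out hp.out).mp (hr.out.dvd_of_dvd_pow hd))
  have := Fintype.ofFinite X
  rw [Nat.card_eq_fintype_card] at hrX
  obtain ⟨x, hx⟩ := Equiv.Perm.exists_fixed_point_of_prime hrX hσr
  have hxC : (x : N) ∈ C := (hC _).mpr (congrArg Subtype.val hx)
  have : m = x * (m⁻¹ * x)⁻¹ := by group
  rw [this]
  exact Subgroup.mul_mem_sup hxC (Subgroup.inv_mem _ x.2)

end Frattini

/-- The action of a group on the Frattini quotient of a finite normal `p`-subgroup, as a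
homomorphism to a ring. -/
theorem exists_frattini_representation {G : Type u} [Group G] {p : ℕ} [Fact p.Prime]
    {N : Subgroup G} [Finite N] [N.Normal] (hN : IsPGroup p N) (hbot : N ≠ ⊥) :
    ∃ (E : Type u) (_ : Ring E) (_ : CharP E p) (ρ : G →* E),
      (∀ g, ρ g = 1 ↔ ∀ n : N, n⁻¹ * MulAut.conjNormal g n ∈ frattini N) ∧
      ∀ g, (∀ n ∈ N, ⁅g, ⁅g, n⁆⁆ = 1) → (ρ g - 1) ^ 2 = 0 := by
  let _ : CommGroup (N ⧸ frattini N) :=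
    { (inferInstance : Group (N ⧸ frattini N)) with
      mul_comm := fun a b => by
        obtain ⟨a, rfl⟩ := QuotientGroup.mk_surjective a
        obtain ⟨b, rfl⟩ := QuotientGroup.mk_surjective b
        rw [← commutatorElement_eq_one_iff_mul_comm]
        exact (QuotientGroup.eq_one_iff _).mpr (hN.commutator_mem_frattini a b) }
  let V := N ⧸ frattini N
  let mk : N → Additive V := fun n => Additive.ofMul (QuotientGroup.mk n)
  have hmk : Function.Surjective mk := QuotientGroup.mk_surjective
  have mk_eq_zero : ∀ a, mk a = 0 ↔ a ∈ frattini N := fun a => QuotientGroup.eq_one_iff a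
  have mk_eq : ∀ a b, mk a = mk b ↔ a⁻¹ * b ∈ frattini N := fun a b => QuotientGroup.eq
  have hle : ∀ g : G, frattini N ≤
      (frattini N).comap (MulAut.conjNormal g : MulAut N).toMonoidHom := fun g =>
    (Subgroup.characteristic_iff_le_comap.mp frattini_characteristic _)
  let s : G → AddMonoid.End (Additive V) := fun g =>
    MonoidHom.toAdditive (QuotientGroup.map _ _ (MulAut.conjNormal g : MulAut N).toMonoidHom
      (hle g))
  have hs : ∀ g n, s g (mk n) = mk (MulAut.conjNormal g n) := fun _ _ => rfl
  have hext : ∀ f g : AddMonoid.End (Additive V), (∀ n, f (mk n) = g (mk n)) → f = g :=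
    fun f g h => AddMonoidHom.ext fun v => by
      obtain ⟨n, rfl⟩ := hmk v
      exact h n
  let ρ : G →* AddMonoid.End (Additive V) :=
    { toFun := s
      map_one' := hext _ _ fun n => (hs 1 n).trans (by rw [map_one]; rfl)
      map_mul' := fun g h => hext _ _ fun n => (hs (g * h) n).trans (by rw [map_mul]; rfl) }
  have hρ : ∀ g n, ρ g (mk n) = mk (MulAut.conjNormal g n) := fun _ _ => rfl
  have hnt : Nontrivial (AddMonoid.End (Additive V)) := by
    have hfr : frattini N ≠ ⊤ := by
      intro h
      have h1 : (⊥ : Subgroup N) = ⊤ := frattini_nongenerating (by rw [h, sup_top_eq])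
      refine hbot ((Subgroup.eq_bot_iff_forall _).mpr fun x hx => ?_)
      have : (⟨x, hx⟩ : N) ∈ (⊥ : Subgroup N) := h1 ▸ Subgroup.mem_top _
      exact congrArg Subtype.val (Subgroup.mem_bot.mp this)
    obtain ⟨n, hn⟩ : ∃ n, n ∉ frattini N := by
      by_contra! h
      exact hfr (eq_top_iff.mpr fun x _ => h x)
    refine ⟨⟨1, 0, fun h => hn ((mk_eq_zero n).mp ?_)⟩⟩
    exact congrArg (fun f : AddMonoid.End (Additive V) => f (mk n)) h
  have hchar : CharP (AddMonoid.End (Additive V)) p := by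
    rw [CharP.charP_iff_prime_eq_zero Fact.out]
    refine hext _ _ fun n => (AddMonoid.End.natCast_apply p (mk n)).trans ?_
    exact (mk_eq_zero (n ^ p)).mpr (hN.pow_mem_frattini n)
  have hsub : ∀ g n, (ρ g - 1) (mk n) = mk (MulAut.conjNormal g n * n⁻¹) := fun g n => by
    refine (AddMonoidHom.sub_apply (ρ g) (1 : AddMonoid.End (Additive V)) (mk n)).trans ?_
    rw [sub_eq_add_neg]
    rfl
  refine ⟨_, inferInstance, hchar, ρ, fun g => ⟨fun h n => ?_, fun h => ?_⟩, fun g hg => ?_⟩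
  · rw [← mk_eq, ← hρ, h]
    rfl
  · exact hext _ _ fun n => ((mk_eq _ _).mpr (h n)).symm
  · rw [sq]
    refine hext _ _ fun n => ?_
    change (ρ g - 1) ((ρ g - 1) (mk n)) = 0
    rw [hsub, hsub, mk_eq_zero]
    convert one_mem (frattini N)
    have := hg n n.2
    ext
    simp only [Subgroup.coe_mul, Subgroup.coe_inv, MulAut.conjNormal_apply, OneMemClass.coe_one]
    rw [← this]
    simp [commutatorElement_def]

/-! ### Subgroups of class two acting on `p'`-sections. -/

theorem mem_of_pow_mem_of_coprime {G : Type u} [Group G] {N : Subgroup G} [N.Normal] {g : G}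
    {m n : ℕ} (hmn : m.Coprime n) (hm : g ^ m ∈ N) (hn : g ^ n ∈ N) : g ∈ N := by
  rw [← QuotientGroup.eq_one_iff] at *
  exact eq_one_of_pow_eq_one_of_coprime hmn hm hn

variable {G : Type u} [Group G] [Finite G] {p : ℕ} [hp : Fact p.Prime]

/-- Let `N` be a normal `p`-subgroup and `N ≤ K` with `K / N` a `p'`-group with abelian Sylow
`2`-subgroups. Then a `p`-subgroup of class at most two containing `N` centralises `K / N`. -/
theorem commutator_mem_of_class_two [Group.IsSolvable G] (hp2 : p ≠ 2) {N K P : Subgroup G}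
    [N.Normal] [hKn : K.Normal] (hN : IsPGroup p N) (hNP : N ≤ P)
    (hindex : ¬ p ∣ N.relIndex K) (hcent : K ⊓ Subgroup.centralizer (N : Set G) ≤ N)
    (hcomm : ∀ T ≤ K, IsPGroup 2 T → ∀ a ∈ T, ∀ b ∈ T, a * b = b * a)
    (hclass : ∀ a ∈ P, ∀ b ∈ P, ∀ c ∈ P, ⁅⁅a, b⁆, c⁆ = 1) {y k : G} (hy : y ∈ P) (hk : k ∈ K) :
    ⁅y, k⁆ ∈ N := by
  by_cases hbot : N = ⊥
  · have : K ≤ N := by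
      refine le_trans (le_inf le_rfl fun x _ => ?_) hcent
      rw [hbot, Subgroup.mem_centralizer_iff]
      intro h hh
      rw [Subgroup.mem_bot.mp hh, one_mul, mul_one]
    rw [commutatorElement_def]
    exact N.mul_mem (Subgroup.Normal.conj_mem inferInstance k (this hk) y) (N.inv_mem (this hk))
  obtain ⟨E, _, _, ρ, hker, hquad⟩ := exists_frattini_representation hN hbot
  -- In this linear group `N` becomes trivial, so `K` maps to a normal `p'`-subgroup.
  let f : G →* ρ.toHomUnits.range := ρ.toHomUnits.rangeRestrict
  have hf : Function.Surjective f := ρ.toHomUnits.rangeRestrict_surjective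
  have hfker : ∀ g, g ∈ f.ker ↔ ρ g = 1 := fun g => by
    rw [MonoidHom.mem_ker, Subtype.ext_iff, Units.ext_iff]
    rfl
  let τ : ρ.toHomUnits.range →* E := (Units.coeHom E).comp (Subgroup.subtype _)
  have hτ : Function.Injective τ := Units.val_injective.comp Subtype.val_injective
  have hτf : ∀ g, τ (f g) = ρ g := fun _ => rfl
  have : Finite ρ.toHomUnits.range := Finite.of_surjective f hf
  have : Group.IsSolvable ρ.toHomUnits.range := Group.isSolvable_of_surjective hf
  have : (K.map f).Normal := hKn.map f hf
  have hNker : N ≤ f.ker := fun m hm => by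
    rw [hfker, hker]
    intro n
    have h1 : n⁻¹ * MulAut.conjNormal m n = ⁅n⁻¹, ⟨m, hm⟩⁆ := by
      ext
      simp [commutatorElement_def, mul_assoc]
    rw [h1]
    exact hN.commutator_mem_frattini _ _
  have hcop : ¬ p ∣ Nat.card (K.map f) := fun h => hindex (by
    rw [← Subgroup.relIndex_ker] at h
    exact h.trans (Subgroup.relIndex_dvd_of_le_left _ hNker))
  have key := commute_of_quadratic hp2 τ hτ (y := f y) (by
    rw [hτf]
    refine hquad y fun n hn => ?_
    rw [← commutatorElement_inv, inv_eq_one]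
    exact hclass y hy n (hNP hn) y hy) hcop (fun T hT hT2 a ha b hb => by
      obtain ⟨S, hSK, hS2, hTS⟩ := exists_isPGroup_le_map f hT2 hT
      obtain ⟨a, haS, rfl⟩ := hTS ha
      obtain ⟨b, hbS, rfl⟩ := hTS hb
      rw [← map_mul, ← map_mul, hcomm S hSK hS2 a haS b hbS]) (Subgroup.mem_map_of_mem f hk)
  have hmem : ⁅y, k⁆ ∈ K ⊓ f.ker := by
    refine Subgroup.mem_inf.mpr ⟨?_, ?_⟩
    · rw [commutatorElement_def]
      exact K.mul_mem (hKn.conj_mem k hk y) (K.inv_mem hk)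
    · rw [MonoidHom.mem_ker, map_commutatorElement, commutatorElement_eq_one_iff_mul_comm, key]
  -- An element of prime order `r ≠ p` here would act trivially on the Frattini quotient, hence on
  -- `N`, and so would lie in `N` by `hcent`.
  have hL : IsPGroup p (K ⊓ f.ker : Subgroup G) := by
    rw [← primesIn_eq_iff]
    intro r hr hrd
    by_contra hrp
    have : Fact r.Prime := ⟨hr⟩
    obtain ⟨⟨g, hgL⟩, hg⟩ := exists_prime_orderOf_dvd_card' r hrd
    rw [Subgroup.orderOf_mk] at hg
    obtain ⟨hgK, hgf⟩ := Subgroup.mem_inf.mp hgL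
    have hα : (MulAut.conjNormal g : MulAut N) ^ r = 1 := by
      rw [← map_pow, ← hg, pow_orderOf_eq_one, map_one]
    have h1 := hN.eq_self_of_frattini hrp hα ((hker g).mp ((hfker g).mp hgf))
    have hgN : g ∈ N := by
      refine hcent ⟨hgK, Subgroup.mem_centralizer_iff.mpr fun n hn => ?_⟩
      have := congrArg Subtype.val (h1 ⟨n, hn⟩)
      rw [MulAut.conjNormal_apply, mul_inv_eq_iff_eq_mul] at this
      exact this.symm
    have h2 : r ∣ Nat.card N := hg ▸ Subgroup.orderOf_dvd_natCard N hgN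
    exact hrp (primesIn_eq_iff.mpr hN r hr h2)
  obtain ⟨m, hm⟩ := hL ⟨_, hmem⟩
  have hm' : ⁅y, k⁆ ^ p ^ m = 1 := congrArg Subtype.val hm
  refine mem_of_pow_mem_of_coprime (m := p ^ m) (n := N.relIndex K) ?_ ?_ ?_
  · exact Nat.Coprime.pow_left _ ((Nat.Prime.coprime_iff_not_dvd hp.out).mpr hindex)
  · rw [hm']
    exact N.one_mem
  · exact Subgroup.pow_relIndex_mem N hmem.1

/-! ### Normal Sylow subgroups when the Sylow `2`-subgroups are abelian. -/

/-- All `p`-subgroups have class at most two. -/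
def PSubgroupsClassTwo (p : ℕ) (G : Type u) [Group G] : Prop :=
  ∀ P : Subgroup G, IsPGroup p P → ∀ a ∈ P, ∀ b ∈ P, ∀ c ∈ P, ⁅⁅a, b⁆, c⁆ = 1

/-- All `p`-subgroups are abelian. -/
def PSubgroupsCommutative (p : ℕ) (G : Type u) [Group G] : Prop :=
  ∀ P : Subgroup G, IsPGroup p P → ∀ a ∈ P, ∀ b ∈ P, a * b = b * a

section

variable {G : Type u} [Group G] [Finite G] {p : ℕ} [hp : Fact p.Prime]

theorem Subgroup.card_eq_card_mul_relIndex {G : Type u} [Group G] {K L : Subgroup G} (h : K ≤ L) :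
    Nat.card L = Nat.card K * K.relIndex L := by
  rw [← Subgroup.card_mul_index (K.subgroupOf L), Subgroup.relIndex]
  congr 1
  exact Nat.card_congr (Subgroup.subgroupOfEquivOfLe h).toEquiv

theorem Subgroup.card_comap_mk' {G : Type u} [Group G] {K : Subgroup G} [K.Normal]
    (L : Subgroup (G ⧸ K)) :
    Nat.card (L.comap (QuotientGroup.mk' K)) = Nat.card K * Nat.card L := by
  have h1 : K ≤ L.comap (QuotientGroup.mk' K) := by
    conv_lhs => rw [← QuotientGroup.ker_mk' K]
    exact MonoidHom.ker_le_comap _ _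
  have h2 := Subgroup.relIndex_ker (K := L.comap (QuotientGroup.mk' K)) (QuotientGroup.mk' K)
  rw [QuotientGroup.ker_mk',
    Subgroup.map_comap_eq_self_of_surjective (QuotientGroup.mk'_surjective K)] at h2
  rw [Subgroup.card_eq_card_mul_relIndex h1, h2]

theorem PSubgroupsClassTwo.of_surjective {G' : Type v} [Group G'] {f : G →* G'}
    (hf : Function.Surjective f) (h : PSubgroupsClassTwo p G) : PSubgroupsClassTwo p G' := by
  intro P hP a ha b hb c hc
  obtain ⟨S, -, hS, hle⟩ := exists_isPGroup_le_map f (K := ⊤) hP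
    (by rw [Subgroup.map_top_of_surjective f hf]; exact le_top)
  obtain ⟨a, haS, rfl⟩ := hle ha
  obtain ⟨b, hbS, rfl⟩ := hle hb
  obtain ⟨c, hcS, rfl⟩ := hle hc
  rw [← map_commutatorElement, ← map_commutatorElement, h S hS a haS b hbS c hcS, map_one]

theorem PSubgroupsCommutative.of_surjective {G' : Type v} [Group G'] {f : G →* G'}
    (hf : Function.Surjective f) (h : PSubgroupsCommutative p G) :
    PSubgroupsCommutative p G' := by
  intro P hP a ha b hb
  obtain ⟨S, -, hS, hle⟩ := exists_isPGroup_le_map f (K := ⊤) hP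
    (by rw [Subgroup.map_top_of_surjective f hf]; exact le_top)
  obtain ⟨a, haS, rfl⟩ := hle ha
  obtain ⟨b, hbS, rfl⟩ := hle hb
  rw [← map_mul, ← map_mul, h S hS a haS b hbS]

theorem PSubgroupsClassTwo.subgroup {G : Type u} [Group G] {p : ℕ}
    (h : PSubgroupsClassTwo p G) (H : Subgroup G) :
    PSubgroupsClassTwo p H := fun P hP a ha b hb c hc =>
  Subtype.ext (h (P.map H.subtype) (hP.map _) a ⟨a, ha, rfl⟩ b ⟨b, hb, rfl⟩ c ⟨c, hc, rfl⟩)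

theorem eq_bot_of_primesIn_quotient {G : Type u} [Group G] {π : ℕ → Prop} {K : Subgroup G}
    [K.Normal]
    (hK : PrimesIn π (Nat.card K))
    (hmax : ∀ L : Subgroup G, L.Normal → PrimesIn π (Nat.card L) → L ≤ K)
    (L : Subgroup (G ⧸ K)) (hLn : L.Normal) (hL : PrimesIn π (Nat.card L)) : L = ⊥ := by
  have h1 : L.comap (QuotientGroup.mk' K) ≤ K := hmax _ inferInstance fun r hr hrd => by
    rw [Subgroup.card_comap_mk', hr.dvd_mul] at hrd
    exact hrd.elim (hK r hr) (hL r hr)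
  rw [Subgroup.eq_bot_iff_forall]
  intro x hx
  obtain ⟨g, rfl⟩ := QuotientGroup.mk_surjective x
  exact (QuotientGroup.eq_one_iff g).mpr (h1 hx)

theorem HasAffineAction.of_quotient {G : Type u} [Group G] [Finite G] {p : ℕ}
    {K : Subgroup G} [K.Normal] (hK : ¬ p ∣ Nat.card K)
    (h : HasAffineAction (G ⧸ K) (p ^ (Nat.card (G ⧸ K)).factorization p)) :
    HasAffineAction G (p ^ (Nat.card G).factorization p) := by
  have : (Nat.card G).factorization p = (Nat.card (G ⧸ K)).factorization p := by
    rw [Subgroup.card_eq_card_quotient_mul_card_subgroup K,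
      Nat.factorization_mul Nat.card_pos.ne' Nat.card_pos.ne', Finsupp.add_apply,
      Nat.factorization_eq_zero_of_not_dvd hK, add_zero]
  rw [this]
  exact h.comap (QuotientGroup.mk' K) (QuotientGroup.mk'_surjective K)

theorem IsPGroup.not_dvd_card_of_ne {H : Type u} [Group H] [Finite H] {r : ℕ} [Fact r.Prime]
    (hH : IsPGroup r H) (hrp : r ≠ p) : ¬ p ∣ Nat.card H := fun h =>
  hrp (primesIn_eq_iff.mpr hH p hp.out h).symm

theorem IsPGroup.le_of_not_dvd_relIndex {G : Type u} [Group G] {p : ℕ} [hp : Fact p.Prime]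
    {N K L : Subgroup G} [N.Normal] (hL : IsPGroup p L)
    (hLK : L ≤ K) (hindex : ¬ p ∣ N.relIndex K) : L ≤ N := by
  intro x hx
  obtain ⟨m, hm⟩ := hL ⟨x, hx⟩
  have hm' : x ^ p ^ m = 1 := congrArg Subtype.val hm
  refine mem_of_pow_mem_of_coprime (m := p ^ m) (n := N.relIndex K) ?_ ?_ ?_
  · exact Nat.Coprime.pow_left _ ((Nat.Prime.coprime_iff_not_dvd hp.out).mpr hindex)
  · rw [hm']
    exact N.one_mem
  · exact Subgroup.pow_relIndex_mem N (hLK hx)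

variable [Group.IsSolvable G]

/-- In a finite solvable group with `O_p'(G) = 1` the centraliser of `O_p(G)` is contained in
`O_p(G)`. -/
theorem centralizer_le_of_isPGroup
    (hO : ∀ L : Subgroup G, L.Normal → ¬ p ∣ Nat.card L → L = ⊥) {N : Subgroup G} [N.Normal]
    (hN : ∀ L : Subgroup G, L.Normal → IsPGroup p L → L ≤ N) :
    Subgroup.centralizer (N : Set G) ≤ N :=
  centralizer_le_of_forall_primesIn_le (π := (· = p))
    (fun r hr hrp R hRn hR =>
      have : Fact r.Prime := ⟨hr⟩
      hO R hRn (hR.not_dvd_card_of_ne hrp))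
    fun L hLn hL => hN L hLn (primesIn_eq_iff.mp hL)

/-- A finite solvable group with `O_p'(G) = 1`, `p` odd, abelian Sylow `2`-subgroups and Sylow
`p`-subgroups of class at most two has a normal Sylow `p`-subgroup. -/
theorem exists_normal_sylow_of_commutative (hp2 : p ≠ 2)
    (hO : ∀ L : Subgroup G, L.Normal → ¬ p ∣ Nat.card L → L = ⊥)
    (hcomm : PSubgroupsCommutative 2 G) (hclass : PSubgroupsClassTwo p G) :
    ∃ N : Subgroup G, N.Normal ∧ IsPGroup p N ∧ ¬ p ∣ N.index := by
  obtain ⟨N, hNchar, hN, hNmax⟩ := exists_characteristic_primesIn (· = p) G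
  have hNp : IsPGroup p N := primesIn_eq_iff.mp hN
  have hNmax' : ∀ L : Subgroup G, L.Normal → IsPGroup p L → L ≤ N := fun L hLn hL =>
    hNmax L hLn (primesIn_eq_iff.mpr hL)
  have hcent := centralizer_le_of_isPGroup hO hNmax'
  obtain ⟨Q, hQchar, hQ, hQmax⟩ := exists_characteristic_primesIn (· ≠ p) (G ⧸ N)
  have hQp : ¬ p ∣ Nat.card Q := (primesIn_ne_iff hp.out).mp hQ
  have hcentQ : Subgroup.centralizer (Q : Set (G ⧸ N)) ≤ Q :=
    centralizer_le_of_forall_primesIn_le (π := (· ≠ p)) (fun r hr hrp R hRn hR => by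
      rw [not_not] at hrp
      subst hrp
      exact eq_bot_of_primesIn_quotient hN hNmax R hRn (primesIn_eq_iff.mpr hR)) hQmax
  let K := Q.comap (QuotientGroup.mk' N)
  have hNK : N ≤ K := by
    conv_lhs => rw [← QuotientGroup.ker_mk' N]
    exact MonoidHom.ker_le_comap _ _
  have hrel : ¬ p ∣ N.relIndex K := by
    have h1 := Subgroup.card_comap_mk' Q
    rw [Subgroup.card_eq_card_mul_relIndex hNK] at h1
    rwa [Nat.eq_of_mul_eq_mul_left Nat.card_pos h1]
  obtain ⟨P, hNP⟩ := hNp.exists_le_sylow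
  -- Modulo `N`, the Sylow subgroup `P` centralises `Q`, which contains its own centraliser.
  have hPK : (P : Subgroup G) ≤ K := by
    intro y hy
    refine hcentQ (Subgroup.mem_centralizer_iff.mpr fun x hx => ?_)
    obtain ⟨k, rfl⟩ := QuotientGroup.mk_surjective x
    have := commutator_mem_of_class_two hp2 (K := K) (P := P) hNp hNP hrel
      (inf_le_right.trans hcent) (fun T _ hT => hcomm T hT) (hclass P P.isPGroup') hy (k := k) hx
    rw [← QuotientGroup.eq_one_iff, ← QuotientGroup.mk'_apply, map_commutatorElement,
      commutatorElement_eq_one_iff_mul_comm] at this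
    exact this.symm
  have hPN : (P : Subgroup G) ≤ N := P.isPGroup'.le_of_not_dvd_relIndex hPK hrel
  exact ⟨N, inferInstance, hNp, fun h => P.not_dvd_index (h.trans (Subgroup.index_dvd_of_le hPN))⟩

theorem HasAffineAction.of_commutative (hp2 : p ≠ 2) (hcomm : PSubgroupsCommutative 2 G)
    (hclass : PSubgroupsClassTwo p G) :
    HasAffineAction G (p ^ (Nat.card G).factorization p) := by
  obtain ⟨O, hOchar, hO, hOmax⟩ := exists_characteristic_primesIn (· ≠ p) G
  have hclass' := hclass.of_surjective (QuotientGroup.mk'_surjective O)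
  obtain ⟨N, hNn, hN, hindex⟩ := exists_normal_sylow_of_commutative (G := G ⧸ O) hp2
    (fun L hLn hL => eq_bot_of_primesIn_quotient hO hOmax L hLn
      ((primesIn_ne_iff hp.out).mpr hL))
    (hcomm.of_surjective (QuotientGroup.mk'_surjective O)) hclass'
  exact of_quotient ((primesIn_ne_iff hp.out).mp hO)
    (of_normal_sylow_of_class_two hp2 hN hindex (hclass' N hN))

end

/-! ### Groups with quaternion Sylow `2`-subgroups. -/

/-- The Sylow `2`-subgroups are isomorphic to the quaternion group of order `8`. -/
def HasQuaternionSylow (G : Type u) [Group G] : Prop :=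
  ∀ P : Sylow 2 G, Nonempty (P ≃* QuaternionGroup 2)

section

variable {G : Type u} [Group G]

theorem HasQuaternionSylow.exists_injective (hQ : HasQuaternionSylow G) {T : Subgroup G}
    (hT : IsPGroup 2 T) : ∃ φ : T →* QuaternionGroup 2, Function.Injective φ := by
  obtain ⟨P, hP⟩ := hT.exists_le_sylow
  obtain ⟨e⟩ := hQ P
  exact ⟨e.toMonoidHom.comp (Subgroup.inclusion hP),
    e.injective.comp (Subgroup.inclusion_injective hP)⟩

theorem QuaternionGroup.eq_of_mul_self_eq_one :
    ∀ a b : QuaternionGroup 2, a * a = 1 → b * b = 1 → a ≠ 1 → b ≠ 1 → a = b := by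
  decide +kernel

theorem QuaternionGroup.pow_four : ∀ a : QuaternionGroup 2, a ^ 4 = 1 := by
  decide +kernel

theorem QuaternionGroup.commutator_mul_self :
    ∀ a b : QuaternionGroup 2, ⁅a, b⁆ * ⁅a, b⁆ = 1 := by
  decide +kernel

/-- Two involutions in a common `2`-subgroup coincide. -/
theorem HasQuaternionSylow.eq_of_mul_self_eq_one (hQ : HasQuaternionSylow G) {T : Subgroup G}
    (hT : IsPGroup 2 T) {a b : G} (ha : a ∈ T) (hb : b ∈ T) (haa : a * a = 1) (hbb : b * b = 1)
    (ha1 : a ≠ 1) (hb1 : b ≠ 1) : a = b := by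
  obtain ⟨φ, hφ⟩ := hQ.exists_injective hT
  have h1 : ∀ x : G, ∀ hx : x ∈ T, x ≠ 1 → φ ⟨x, hx⟩ ≠ 1 := fun x hx hx1 h =>
    hx1 (congrArg Subtype.val ((map_eq_one_iff φ hφ).mp h))
  have h2 : ∀ x : G, ∀ hx : x ∈ T, x * x = 1 → φ ⟨x, hx⟩ * φ ⟨x, hx⟩ = 1 := fun x hx hxx => by
    rw [← map_mul, map_eq_one_iff φ hφ]
    exact Subtype.ext hxx
  exact congrArg Subtype.val (hφ (QuaternionGroup.eq_of_mul_self_eq_one _ _ (h2 a ha haa)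
    (h2 b hb hbb) (h1 a ha ha1) (h1 b hb hb1)))

theorem HasQuaternionSylow.pow_four (hQ : HasQuaternionSylow G) {T : Subgroup G}
    (hT : IsPGroup 2 T) {a : G} (ha : a ∈ T) : a ^ 4 = 1 := by
  obtain ⟨φ, hφ⟩ := hQ.exists_injective hT
  have h := QuaternionGroup.pow_four (φ ⟨a, ha⟩)
  rw [← map_pow, map_eq_one_iff φ hφ] at h
  exact congrArg Subtype.val h

theorem HasQuaternionSylow.commutator_mul_self (hQ : HasQuaternionSylow G) {T : Subgroup G}
    (hT : IsPGroup 2 T) {a b : G} (ha : a ∈ T) (hb : b ∈ T) : ⁅a, b⁆ * ⁅a, b⁆ = 1 := by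
  obtain ⟨φ, hφ⟩ := hQ.exists_injective hT
  have h := QuaternionGroup.commutator_mul_self (φ ⟨a, ha⟩) (φ ⟨b, hb⟩)
  rw [← map_commutatorElement, ← map_mul, map_eq_one_iff φ hφ] at h
  exact congrArg Subtype.val h

variable [Finite G]

theorem HasQuaternionSylow.quotient (hQ : HasQuaternionSylow G) {K : Subgroup G} [K.Normal]
    (hK : ¬ 2 ∣ Nat.card K) : HasQuaternionSylow (G ⧸ K) := by
  intro P'
  obtain ⟨P, rfl⟩ := Sylow.mapSurjective_surjective (QuotientGroup.mk'_surjective K) 2 P'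
  obtain ⟨e⟩ := hQ P
  refine ⟨(MulEquiv.ofBijective ((QuotientGroup.mk' K).subgroupMap P) ⟨?_, ?_⟩).symm.trans e⟩
  · rw [injective_iff_map_eq_one]
    intro x hx
    have hxK : (x : G) ∈ K := (QuotientGroup.eq_one_iff (x : G)).mp (congrArg Subtype.val hx)
    obtain ⟨m, hm⟩ := P.isPGroup' x
    refine Subtype.ext (eq_one_of_pow_eq_one_of_coprime (m := 2 ^ m) (n := Nat.card K) ?_
      (congrArg Subtype.val hm) (pow_card_eq_one_of_mem hxK))
    exact Nat.Coprime.pow_left _ ((Nat.Prime.coprime_iff_not_dvd Nat.prime_two).mpr hK)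
  · exact MonoidHom.subgroupMap_surjective _ _

variable [Group.IsSolvable G]

/-- A finite solvable group with Sylow `2`-subgroups `Q₈` and no nontrivial normal subgroup of odd
order has a normal Sylow `2`-subgroup. -/
theorem HasQuaternionSylow.exists_normal (hQ : HasQuaternionSylow G)
    (hO : ∀ L : Subgroup G, L.Normal → ¬ 2 ∣ Nat.card L → L = ⊥) :
    ∃ P : Sylow 2 G, (P : Subgroup G).Normal := by
  obtain ⟨T, hTchar, hT2, hTmax⟩ := exists_characteristic_primesIn (· = 2) G
  have hT : IsPGroup 2 T := primesIn_eq_iff.mp hT2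
  have hcent := centralizer_le_of_isPGroup hO (N := T)
    fun L hLn hL => hTmax L hLn (primesIn_eq_iff.mpr hL)
  obtain ⟨P, hTP⟩ := hT.exists_le_sylow
  suffices h : T = P from ⟨P, h ▸ inferInstance⟩
  obtain ⟨e⟩ := hQ P
  have hP8 : Nat.card P = 8 := by
    rw [Nat.card_congr e.toEquiv, Nat.card_eq_fintype_card, QuaternionGroup.card]
  by_cases h8 : 8 ≤ Nat.card T
  · exact Subgroup.eq_of_le_of_card_ge hTP (hP8.trans_le h8)
  have h4 : Nat.card T ≤ 4 := by
    have hdvd : Nat.card T ∣ 8 := hP8 ▸ Subgroup.card_dvd_of_le hTP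
    generalize Nat.card T = n at *
    have : n < 8 := by omega
    interval_cases n <;> omega
  -- If `|T| ≤ 4`, then `T` is cyclic with at most two automorphisms. Elements of odd prime order
  -- therefore centralise `T` and lie in it, which is absurd.
  suffices hG : PrimesIn (· = 2) (Nat.card G) by
    refine le_antisymm hTP (le_top.trans (hTmax ⊤ inferInstance ?_))
    rwa [Subgroup.card_top]
  intro r hr hrd
  by_contra hr2
  have : Fact r.Prime := ⟨hr⟩
  obtain ⟨g, hg⟩ := exists_prime_orderOf_dvd_card' r hrd
  have hgr : g ^ r = 1 := hg ▸ pow_orderOf_eq_one g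
  suffices hgT : g ∈ T by
    have h1 : r ∣ Nat.card T := hg ▸ Subgroup.orderOf_dvd_natCard T hgT
    exact hr2 (hT2 r hr h1)
  refine hcent (Subgroup.mem_centralizer_iff.mpr fun t ht => ?_)
  have hgt : g * t * g⁻¹ ∈ T := Subgroup.Normal.conj_mem inferInstance t ht g
  by_cases ht2 : t * t = 1
  · by_cases ht1 : t = 1
    · rw [ht1, one_mul, mul_one]
    · have := hQ.eq_of_mul_self_eq_one hT hgt ht (by
        rw [conj_mul, ht2, mul_one, mul_inv_cancel]) ht2 (by rwa [Ne, conj_eq_one_iff]) ht1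
      rw [mul_inv_eq_iff_eq_mul] at this
      exact this.symm
  · have ht4 : t ^ 4 = 1 := hQ.pow_four hT ht
    have hz : Subgroup.zpowers t = T := by
      refine Subgroup.eq_of_le_of_card_ge (by rwa [Subgroup.zpowers_le]) ?_
      rw [Nat.card_zpowers, orderOf_eq_prime_pow (p := 2) (n := 1) (by rwa [pow_one, sq]) ht4]
      exact h4
    have hinv : g * t * g⁻¹ = t ∨ g * t * g⁻¹ = t⁻¹ := by
      obtain ⟨i, hi⟩ := Subgroup.mem_zpowers_iff.mp (hz.symm ▸ hgt)
      have h4i : ∀ j : ℤ, t ^ (4 * j) = 1 := fun j => by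
        rw [zpow_mul, show (4 : ℤ) = (4 : ℕ) from rfl, zpow_natCast, ht4, one_zpow]
      rcases Int.even_or_odd' i with ⟨j, rfl | rfl⟩
      · refine absurd ?_ ht2
        have h1 : g * (t * t) * g⁻¹ = 1 := by
          rw [← conj_mul, ← hi, ← zpow_add, ← h4i j]
          congr 1
          ring
        rwa [conj_eq_one_iff] at h1
      · rcases Int.even_or_odd' j with ⟨k, rfl | rfl⟩
        · left
          rw [← hi, show 2 * (2 * k) + 1 = 4 * k + 1 by ring, zpow_add, h4i, one_mul, zpow_one]
        · right
          rw [← hi, show 2 * (2 * k + 1) + 1 = 4 * (k + 1) + -1 by ring, zpow_add, h4i, one_mul,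
            zpow_neg_one]
    -- This suffices, because `g` has odd order and is a power of `g ^ 2`.
    have hg2 : Commute (g ^ 2) t := by
      have h1 : g ^ 2 * t * (g ^ 2)⁻¹ = t := by
        rw [show g ^ 2 * t * (g ^ 2)⁻¹ = g * (g * t * g⁻¹) * g⁻¹ by
          rw [sq, mul_inv_rev]
          simp only [mul_assoc]]
        rcases hinv with h | h
        · rw [h, h]
        · rw [h, ← conj_inv, h, inv_inv]
      exact mul_inv_eq_iff_eq_mul.mp h1
    obtain ⟨k, hk⟩ := hr.odd_of_ne_two hr2
    have hgk : g = (g ^ 2) ^ (k + 1) := by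
      rw [← pow_mul, mul_add, mul_one, show 2 * k + 2 = r + 1 by omega, pow_succ, hgr, one_mul]
    rw [hgk]
    exact (hg2.pow_left (k + 1)).symm

theorem HasQuaternionSylow.exists_normal_quotient (hQ : HasQuaternionSylow G) {M : Subgroup G}
    [M.Normal] (hM : ¬ 2 ∣ Nat.card M)
    (hmax : ∀ L : Subgroup G, L.Normal → ¬ 2 ∣ Nat.card L → L ≤ M) :
    ∃ P : Sylow 2 (G ⧸ M), (P : Subgroup (G ⧸ M)).Normal :=
  (hQ.quotient hM).exists_normal fun L hLn hL =>
    eq_bot_of_primesIn_quotient ((primesIn_ne_iff Nat.prime_two).mpr hM)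
      (fun L hLn hL => hmax L hLn ((primesIn_ne_iff Nat.prime_two).mp hL)) L hLn
      ((primesIn_ne_iff Nat.prime_two).mpr hL)

theorem HasQuaternionSylow.hasAffineAction (hQ : HasQuaternionSylow G) :
    HasAffineAction G (2 ^ (Nat.card G).factorization 2) := by
  obtain ⟨M, hMchar, hM, hmax⟩ := exists_characteristic_primesIn (· ≠ 2) G
  rw [primesIn_ne_iff Nat.prime_two] at hM
  obtain ⟨P, hP⟩ := hQ.exists_normal_quotient hM
    fun L hLn hL => hmax L hLn ((primesIn_ne_iff Nat.prime_two).mpr hL)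
  obtain ⟨e⟩ := hQ.quotient hM P
  exact .of_quotient hM (.of_normal_quaternionGroup e P.not_dvd_index)

/-- Modulo the largest normal subgroup of odd order there is only one involution. -/
theorem HasQuaternionSylow.inv_mul_mem (hQ : HasQuaternionSylow G) {M : Subgroup G}
    [M.Normal] (hM : ¬ 2 ∣ Nat.card M)
    (hmax : ∀ L : Subgroup G, L.Normal → ¬ 2 ∣ Nat.card L → L ≤ M) {z w : G} (hz : z * z = 1)
    (hw : w * w = 1) (hz1 : z ≠ 1) (hw1 : w ≠ 1) : z⁻¹ * w ∈ M := by
  obtain ⟨P, hP⟩ := hQ.exists_normal_quotient hM hmax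
  have h1 : ∀ x : G, x * x = 1 → x ≠ 1 → (x : G ⧸ M) ≠ 1 := fun x hxx hx1 h => hx1 <| by
    rw [QuotientGroup.eq_one_iff] at h
    refine eq_one_of_pow_eq_one_of_coprime
      ((Nat.Prime.coprime_iff_not_dvd Nat.prime_two).mpr hM) ?_ (pow_card_eq_one_of_mem h)
    rwa [sq]
  have h2 : ∀ x : G, x * x = 1 → (x : G ⧸ M) * x = 1 := fun x hxx => by
    rw [← QuotientGroup.mk_mul, hxx, QuotientGroup.mk_one]
  have h3 : ∀ x : G ⧸ M, x * x = 1 → x ∈ (P : Subgroup (G ⧸ M)) := fun x hxx => by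
    have hx : IsPGroup 2 (Subgroup.zpowers x) :=
      IsPGroup.of_card_dvd_pow (n := 1) (by
        rw [Nat.card_zpowers, pow_one]
        exact orderOf_dvd_of_pow_eq_one (by rwa [sq]))
    have := hx.le_of_not_dvd_relIndex (N := P) (K := ⊤) le_top (by
      rw [Subgroup.relIndex_top_right]
      exact P.not_dvd_index)
    exact this (Subgroup.mem_zpowers x)
  rw [← QuotientGroup.eq]
  exact (hQ.quotient hM).eq_of_mul_self_eq_one P.isPGroup' (h3 _ (h2 z hz)) (h3 _ (h2 w hw))
    (h2 z hz) (h2 w hw) (h1 z hz hz1) (h1 w hw hw1)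

end

/-! ### Centralisers of sections and of involutions. -/

theorem Subgroup.exists_normal_forall_commutator_mem {G : Type u} [Group G] (A B : Subgroup G)
    [A.Normal] [B.Normal] :
    ∃ S : Subgroup G, S.Normal ∧ ∀ g, g ∈ S ↔ ∀ a ∈ A, ⁅g, a⁆ ∈ B := by
  have hn : (A.map (QuotientGroup.mk' B)).Normal :=
    Subgroup.Normal.map inferInstance _ (QuotientGroup.mk'_surjective B)
  refine ⟨(Subgroup.centralizer (A.map (QuotientGroup.mk' B) : Set (G ⧸ B))).comap
    (QuotientGroup.mk' B), inferInstance, fun g => ?_⟩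
  have h : ∀ a, ⁅g, a⁆ ∈ B ↔ (a : G ⧸ B) * g = g * a := fun a => by
    rw [← QuotientGroup.eq_one_iff, ← QuotientGroup.mk'_apply, map_commutatorElement,
      commutatorElement_eq_one_iff_mul_comm]
    exact eq_comm
  simp only [h]
  rw [Subgroup.mem_comap, Subgroup.mem_centralizer_iff]
  constructor
  · exact fun hg a ha => hg a ⟨a, ha, rfl⟩
  · rintro hg _ ⟨a, ha, rfl⟩
    exact hg a ha

section

variable {G : Type u} [Group G] [Finite G]

/-- The part of `G` inverted by an involution `z` that acts trivially modulo an abelian normal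
subgroup of odd order complements the centraliser of `z`. -/
theorem exists_isComplement'_centralizer {G : Type u} [Group G] {Z : Subgroup G} [Z.Normal]
    (hZ : ¬ 2 ∣ Nat.card Z)
    (hcomm : ∀ a ∈ Z, ∀ b ∈ Z, a * b = b * a) {z : G} (hz : z * z = 1)
    (h : ∀ g, ⁅z, g⁆ ∈ Z) :
    ∃ B ≤ Z, B.Normal ∧ B.IsComplement' (Subgroup.centralizer {z}) := by
  have hzinv : z⁻¹ = z := inv_eq_of_mul_eq_one_right hz
  let B : Subgroup G :=
    { carrier := {a | a ∈ Z ∧ z * a * z⁻¹ = a⁻¹}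
      one_mem' := ⟨Z.one_mem, by simp⟩
      mul_mem' := fun {a b} ha hb => ⟨Z.mul_mem ha.1 hb.1, by
        rw [← conj_mul, ha.2, hb.2, ← mul_inv_rev, hcomm b hb.1 a ha.1]⟩
      inv_mem' := fun {a} ha => ⟨Z.inv_mem ha.1, by rw [← conj_inv, ha.2]⟩ }
  have hcop : Nat.Coprime 2 (Nat.card Z) :=
    (Nat.Prime.coprime_iff_not_dvd Nat.prime_two).mpr hZ
  -- The conjugates of `z` differ from `z` by elements of the abelian group `Z`, so all of them act
  -- alike on `Z`.
  have hBn : B.Normal := by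
    refine ⟨fun a ha g => ⟨Subgroup.Normal.conj_mem inferInstance a ha.1 g, ?_⟩⟩
    have h1 : z * (g * a * g⁻¹) * z⁻¹ =
        ⁅z, g⁆ * (g * (z * a * z⁻¹) * g⁻¹) * ⁅z, g⁆⁻¹ := by
      rw [commutatorElement_def]
      group
    rw [h1, ha.2, hcomm _ (h g) _ (Subgroup.Normal.conj_mem inferInstance _ (Z.inv_mem ha.1) g),
      mul_inv_cancel_right, conj_inv]
  refine ⟨B, fun a ha => ha.1, hBn, Subgroup.isComplement'_of_disjoint_and_mul_eq_univ ?_ ?_⟩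
  · rw [Subgroup.disjoint_def]
    intro a ha haJ
    rw [Subgroup.mem_centralizer_singleton_iff] at haJ
    have h1 := ha.2
    rw [← haJ, mul_inv_cancel_right] at h1
    refine eq_one_of_pow_eq_one_of_coprime hcop ?_ (pow_card_eq_one_of_mem ha.1)
    rw [sq]
    exact mul_eq_one_iff_eq_inv.mpr h1
  · refine Set.eq_univ_of_forall fun g => ?_
    have hn : ⁅z, g⁆ ∈ B := ⟨h g, by
      rw [commutatorElement_def, mul_inv_rev, mul_inv_rev, mul_inv_rev, inv_inv, inv_inv, hzinv]
      calc z * (z * g * z * g⁻¹) * z = z * z * (g * z * g⁻¹ * z) := by simp only [mul_assoc]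
        _ = _ := by rw [hz, one_mul]; simp only [mul_assoc]⟩
    obtain ⟨k, hk⟩ : Odd (Nat.card Z) := Nat.not_even_iff_odd.mp fun he => hZ he.two_dvd
    have hpow : ⁅z, g⁆ ^ (2 * k + 1) = 1 := hk ▸ pow_card_eq_one_of_mem hn.1
    -- As `|Z| = 2k + 1`, this power is a square root `b` of `[z, g]`. Since `z g z⁻¹ = b² g` and
    -- `z` inverts `b`, the product `b g` commutes with `z`.
    have hbn : ⁅z, g⁆ ^ (k + 1) ∈ B := B.pow_mem hn _
    refine ⟨(⁅z, g⁆ ^ (k + 1))⁻¹, B.inv_mem hbn, ⁅z, g⁆ ^ (k + 1) * g, ?_,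
      inv_mul_cancel_left _ _⟩
    rw [SetLike.mem_coe, Subgroup.mem_centralizer_singleton_iff]
    refine (mul_inv_eq_iff_eq_mul.mp ?_).symm
    have h2 : z * (⁅z, g⁆ ^ (k + 1) * g) * z⁻¹ =
        z * ⁅z, g⁆ ^ (k + 1) * z⁻¹ * (⁅z, g⁆ * g) := by
      rw [commutatorElement_def]
      group
    rw [h2, hbn.2, ← mul_assoc]
    congr 1
    rw [inv_mul_eq_iff_eq_mul, ← pow_add, show k + 1 + (k + 1) = 2 * k + 1 + 1 by ring, pow_succ,
      hpow, one_mul]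

variable {p : ℕ} [hp : Fact p.Prime] [Group.IsSolvable G]

/-- In a `2`-subgroup containing `z`, commutators square to one, so they are `1` or `z`, the only
involution there. Modulo `z` all `2`-subgroups are therefore abelian. -/
theorem HasQuaternionSylow.hasAffineAction_centralizer (hQ : HasQuaternionSylow G) (hp2 : p ≠ 2)
    (hclass : PSubgroupsClassTwo p G) {z : G} (hz : z * z = 1) (hz1 : z ≠ 1) :
    HasAffineAction (Subgroup.centralizer {z})
      (p ^ (Nat.card (Subgroup.centralizer {z})).factorization p) := by
  let J := Subgroup.centralizer {z}
  let z' : J := ⟨z, Subgroup.mem_centralizer_singleton_iff.mpr rfl⟩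
  let C := Subgroup.zpowers z'
  have hCn : C.Normal := by
    refine ⟨fun a ha g => ?_⟩
    obtain ⟨i, rfl⟩ := Subgroup.mem_zpowers_iff.mp ha
    have h1 : Commute g z' :=
      Subtype.ext (Subgroup.mem_centralizer_singleton_iff.mp g.2)
    rw [(h1.zpow_right i).eq, mul_inv_cancel_right]
    exact ha
  have hC2 : Nat.card C = 2 := by
    rw [Nat.card_zpowers]
    refine orderOf_eq_prime ?_ fun h => hz1 (congrArg Subtype.val h)
    rw [sq]
    exact Subtype.ext hz
  have hCp : ¬ p ∣ Nat.card C := by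
    rw [hC2, Nat.prime_dvd_prime_iff_eq hp.out Nat.prime_two]
    exact hp2
  refine .of_quotient hCp (.of_commutative hp2 (fun P hP a ha b hb => ?_)
    ((hclass.subgroup J).of_surjective (QuotientGroup.mk'_surjective C)))
  obtain ⟨a, rfl⟩ := QuotientGroup.mk_surjective a
  obtain ⟨b, rfl⟩ := QuotientGroup.mk_surjective b
  have hP' : IsPGroup 2 (P.comap (QuotientGroup.mk' C)) := by
    refine hP.comap_of_ker_isPGroup _ ?_
    rw [QuotientGroup.ker_mk']
    exact IsPGroup.of_card (n := 1) (by rw [hC2, pow_one])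
  have hT : IsPGroup 2 ((P.comap (QuotientGroup.mk' C)).map J.subtype) := hP'.map _
  have hzP : z' ∈ P.comap (QuotientGroup.mk' C) := by
    rw [Subgroup.mem_comap, QuotientGroup.mk'_apply,
      (QuotientGroup.eq_one_iff z').mpr (Subgroup.mem_zpowers z')]
    exact P.one_mem
  have hab : ⁅a, b⁆ ∈ C := by
    by_cases h1 : ⁅a, b⁆ = 1
    · rw [h1]
      exact C.one_mem
    · have h2 : ⁅a, b⁆ = z' := by
        refine Subtype.ext (hQ.eq_of_mul_self_eq_one hT ⟨⁅a, b⁆, ?_, rfl⟩ ⟨z', hzP, rfl⟩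
          (hQ.commutator_mul_self hT ⟨a, ha, rfl⟩ ⟨b, hb, rfl⟩) hz
          (fun h => h1 (Subtype.ext h)) hz1)
        rw [commutatorElement_def]
        exact Subgroup.mul_mem _ (Subgroup.mul_mem _ (Subgroup.mul_mem _ ha hb)
          (Subgroup.inv_mem _ ha)) (Subgroup.inv_mem _ hb)
      rw [h2]
      exact Subgroup.mem_zpowers z'
  rwa [← commutatorElement_eq_one_iff_mul_comm, ← QuotientGroup.mk'_apply,
    ← QuotientGroup.mk'_apply, ← map_commutatorElement, QuotientGroup.mk'_apply,
    QuotientGroup.eq_one_iff]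

/-- As `M` has odd order, its `2`-subgroups are trivial and the abelian case applies. The Sylow
subgroup found is characteristic in `M`, hence normal in `G`. -/
theorem exists_normal_sylow_of_odd (hp2 : p ≠ 2) {M : Subgroup G} [M.Normal]
    (hM : ¬ 2 ∣ Nat.card M)
    (hO : ∀ L : Subgroup G, L.Normal → L ≤ M → ¬ p ∣ Nat.card L → L = ⊥)
    (hclass : PSubgroupsClassTwo p G) :
    ∃ N ≤ M, N.Normal ∧ IsPGroup p N ∧ ¬ p ∣ N.relIndex M ∧
      M ⊓ Subgroup.centralizer (N : Set G) ≤ N := by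
  have hO' : ∀ L : Subgroup M, L.Normal → ¬ p ∣ Nat.card L → L = ⊥ := by
    obtain ⟨O, hOchar, hOp, hOmax⟩ := exists_characteristic_primesIn (· ≠ p) M
    have h1 := hO (O.map M.subtype) inferInstance (Subgroup.map_subtype_le O) (by
      rw [Subgroup.card_map_of_injective M.subtype_injective]
      exact (primesIn_ne_iff hp.out).mp hOp)
    rw [Subgroup.map_eq_bot_iff_of_injective _ M.subtype_injective] at h1
    exact fun L hLn hL => le_bot_iff.mp (h1 ▸ hOmax L hLn ((primesIn_ne_iff hp.out).mpr hL))
  obtain ⟨N, hNn, hN, hindex⟩ := exists_normal_sylow_of_commutative (G := M) hp2 hO'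
    (fun T hT a ha b hb => by
      have h1 : Nat.card T = 1 := (hT.card_eq_or_dvd).resolve_right fun h =>
        hM (h.trans (Subgroup.card_subgroup_dvd_card T))
      rw [Subgroup.card_eq_one] at h1
      rw [h1, Subgroup.mem_bot] at ha hb
      rw [ha, hb]) (hclass.subgroup M)
  have hNchar : N.Characteristic :=
    (hN.toSylow hindex).characteristic_of_normal hNn
  have hcent := centralizer_le_of_isPGroup hO' (N := N) fun L _ hL =>
    hL.le_of_not_dvd_relIndex (K := ⊤) le_top (by rwa [Subgroup.relIndex_top_right])
  refine ⟨N.map M.subtype, Subgroup.map_subtype_le N, inferInstance, hN.map _, ?_, ?_⟩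
  · rwa [Subgroup.relIndex, Subgroup.subgroupOf, Subgroup.comap_map_eq_self_of_injective
      M.subtype_injective]
  · intro x hx
    obtain ⟨hxM, hx⟩ := Subgroup.mem_inf.mp hx
    refine ⟨⟨x, hxM⟩, hcent (Subgroup.mem_centralizer_iff.mpr fun n hn => Subtype.ext ?_), rfl⟩
    exact Subgroup.mem_centralizer_iff.mp hx n ⟨n, hn, rfl⟩

end

/-! ### Assembly of the affine actions. -/

section

variable {G : Type u} [Group G] [Finite G] {p : ℕ} [hp : Fact p.Prime]

theorem HasAffineAction.of_isComplement'_of_commutative (hp2 : p ≠ 2) {B J : Subgroup G}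
    [B.Normal] (hB : IsPGroup p B) (hcomm : ∀ a ∈ B, ∀ b ∈ B, a * b = b * a)
    (hc : B.IsComplement' J) (hJ : HasAffineAction J (p ^ (Nat.card J).factorization p)) :
    HasAffineAction G (p ^ (Nat.card G).factorization p) := by
  obtain ⟨k, hk⟩ := IsPGroup.iff_card.mp hB
  have hodd : Odd (Nat.card B) := by
    rw [hk]
    exact (hp.out.odd_of_ne_two hp2).pow
  obtain ⟨_, hbrace, haut⟩ := exists_brace_of_odd_of_class_two hodd fun a b c => by
    have h1 : a * b = b * a := Subtype.ext (hcomm a a.2 b b.2)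
    rw [commutatorElement_eq_one_iff_mul_comm.mpr h1, commutatorElement_one_left]
  have h := HasAffineAction.of_isComplement' hc hbrace (fun g _ => haut _) hJ
  have hf : (Nat.card G).factorization p = k + (Nat.card J).factorization p := by
    rw [← hc.card_mul_card, hk, Nat.factorization_mul (pow_pos hp.out.pos k).ne' Nat.card_pos.ne',
      Finsupp.add_apply, hp.out.factorization_pow, Finsupp.single_eq_same]
  rw [hf, pow_add, ← hk]
  exact h

variable [Group.IsSolvable G]

/-- A Sylow `p`-subgroup centralises both `M/N` and `N/Z(N)`. It is not inside `M`, so the normal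
subgroup `S₁ ⊓ S₂` centralising both sections has even order and contains an involution `z`. Modulo
`M` involutions are unique, so `[z, g] ∈ M`. As `z` inverts `[z, g]`, `[z, [z, g]] = [z, g]⁻²`; odd
order then moves `[z, g]` from `M` into `N` and from `N` into `Z(N)`. -/
theorem HasQuaternionSylow.exists_involution_commutator_mem (hQ : HasQuaternionSylow G)
    (hp2 : p ≠ 2) {M N : Subgroup G} [M.Normal] [N.Normal] (hM : ¬ 2 ∣ Nat.card M)
    (hmax : ∀ L : Subgroup G, L.Normal → ¬ 2 ∣ Nat.card L → L ≤ M)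
    (hN : IsPGroup p N) (hrel : ¬ p ∣ N.relIndex M)
    (hcent : M ⊓ Subgroup.centralizer (N : Set G) ≤ N) (hclass : PSubgroupsClassTwo p G)
    (hp : p ∣ M.index) :
    ∃ z : G, z * z = 1 ∧ z ≠ 1 ∧ ∀ g, ⁅z, g⁆ ∈ N ⊓ Subgroup.centralizer (N : Set G) := by
  have hcop : Nat.Coprime 2 (Nat.card M) :=
    (Nat.Prime.coprime_iff_not_dvd Nat.prime_two).mpr hM
  let Z := N ⊓ Subgroup.centralizer (N : Set G)
  have hZn : Z.Normal := inferInstance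
  obtain ⟨S₁, hS₁n, hS₁⟩ := Subgroup.exists_normal_forall_commutator_mem M N
  obtain ⟨S₂, hS₂n, hS₂⟩ := Subgroup.exists_normal_forall_commutator_mem N Z
  obtain ⟨P, hNP⟩ := hN.exists_le_sylow
  have hPS : (P : Subgroup G) ≤ S₁ ⊓ S₂ := by
    intro y hy
    refine Subgroup.mem_inf.mpr ⟨(hS₁ y).mpr fun k hk => ?_, (hS₂ y).mpr fun n hn => ?_⟩
    · exact commutator_mem_of_class_two hp2 hN hNP hrel hcent
        (fun T hTM hT a ha b hb => by
          have h1 : Nat.card T = 1 := (hT.card_eq_or_dvd).resolve_right fun h =>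
            hM (h.trans (Subgroup.card_dvd_of_le hTM))
          rw [Subgroup.card_eq_one] at h1
          rw [h1, Subgroup.mem_bot] at ha hb
          rw [ha, hb]) (hclass P P.isPGroup') hy hk
    · have hyn : ⁅y, n⁆ ∈ N := by
        rw [commutatorElement_def]
        exact N.mul_mem (Subgroup.Normal.conj_mem inferInstance n hn y) (N.inv_mem hn)
      refine Subgroup.mem_inf.mpr ⟨hyn, Subgroup.mem_centralizer_iff.mpr fun c hc => ?_⟩
      exact (commutatorElement_eq_one_iff_mul_comm.mp
        (hclass P P.isPGroup' y hy n (hNP hn) c (hNP hc))).symm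
  have hS2 : 2 ∣ Nat.card (S₁ ⊓ S₂ : Subgroup G) := by
    by_contra h
    exact P.not_dvd_index (hp.trans
      (Subgroup.index_dvd_of_le (hPS.trans (hmax _ inferInstance h))))
  obtain ⟨⟨z, hzS⟩, hz⟩ := exists_prime_orderOf_dvd_card' 2 hS2
  rw [Subgroup.orderOf_mk] at hz
  have hzz : z * z = 1 := by
    rw [← sq, ← hz, pow_orderOf_eq_one]
  have hzinv : z⁻¹ = z := inv_eq_of_mul_eq_one_right hzz
  have hz1 : z ≠ 1 := fun h => by simp [h] at hz
  obtain ⟨hzS₁, hzS₂⟩ := Subgroup.mem_inf.mp hzS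
  refine ⟨z, hzz, hz1, fun g => ?_⟩
  have hsq : ⁅z, ⁅z, g⁆⁆ = (⁅z, g⁆ ^ 2)⁻¹ := by
    have h1 : z * ⁅z, g⁆ * z⁻¹ = ⁅z, g⁆⁻¹ := by
      rw [commutatorElement_def, mul_inv_rev, mul_inv_rev, mul_inv_rev, inv_inv, inv_inv, hzinv]
      calc z * (z * g * z * g⁻¹) * z = z * z * (g * z * g⁻¹ * z) := by simp only [mul_assoc]
        _ = _ := by rw [hzz, one_mul]; simp only [mul_assoc]
    rw [commutatorElement_def z ⁅z, g⁆, h1, sq, mul_inv_rev]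
  have hgM : ⁅z, g⁆ ∈ M := by
    have h1 := hQ.inv_mul_mem hM hmax (w := g * z * g⁻¹) hzz
      (by rw [conj_mul, hzz, mul_one, mul_inv_cancel]) hz1 (by rwa [Ne, conj_eq_one_iff])
    have h2 : ⁅z, g⁆ = z⁻¹ * (g * z * g⁻¹) := by
      rw [commutatorElement_def, hzinv]
      simp only [mul_assoc]
    rwa [h2]
  have hpow := pow_card_eq_one_of_mem hgM
  have hgN : ⁅z, g⁆ ∈ N := by
    refine mem_of_pow_mem_of_coprime hcop ?_ (hpow ▸ N.one_mem)
    rw [← N.inv_mem_iff, ← hsq]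
    exact (hS₁ z).mp hzS₁ _ hgM
  refine mem_of_pow_mem_of_coprime (N := Z) hcop ?_ (hpow ▸ Z.one_mem)
  rw [← Z.inv_mem_iff, ← hsq]
  exact (hS₂ z).mp hzS₂ _ hgN

theorem HasQuaternionSylow.hasAffineAction_of_forall_eq_bot (hQ : HasQuaternionSylow G)
    (hp2 : p ≠ 2) {M : Subgroup G} [M.Normal] (hM : ¬ 2 ∣ Nat.card M)
    (hmax : ∀ L : Subgroup G, L.Normal → ¬ 2 ∣ Nat.card L → L ≤ M)
    (hO : ∀ L : Subgroup G, L.Normal → L ≤ M → ¬ p ∣ Nat.card L → L = ⊥)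
    (hclass : PSubgroupsClassTwo p G) :
    HasAffineAction G (p ^ (Nat.card G).factorization p) := by
  obtain ⟨N, hNM, hNn, hN, hrel, hcent⟩ := exists_normal_sylow_of_odd hp2 hM hO hclass
  by_cases hindex : p ∣ M.index
  · obtain ⟨z, hz, hz1, h⟩ :=
      hQ.exists_involution_commutator_mem hp2 hM hmax hN hrel hcent hclass hindex
    have hcomm : ∀ a ∈ N ⊓ Subgroup.centralizer (N : Set G),
        ∀ b ∈ N ⊓ Subgroup.centralizer (N : Set G), a * b = b * a := fun a ha b hb =>
      Subgroup.mem_centralizer_iff.mp (Subgroup.mem_inf.mp hb).2 a (Subgroup.mem_inf.mp ha).1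
    obtain ⟨B, hBZ, hBn, hc⟩ := exists_isComplement'_centralizer
      (fun h => hM (h.trans (Subgroup.card_dvd_of_le (inf_le_left.trans hNM)))) hcomm hz h
    exact .of_isComplement'_of_commutative hp2 (hN.to_le (hBZ.trans inf_le_left))
      (fun a ha b hb => hcomm a (hBZ ha) b (hBZ hb)) hc
      (hQ.hasAffineAction_centralizer hp2 hclass hz hz1)
  · refine .of_normal_sylow_of_class_two hp2 hN ?_ (hclass N hN)
    rw [← Subgroup.relIndex_mul_index hNM, hp.out.dvd_mul]
    exact not_or_intro hrel hindex

/-- Factoring out `M ⊓ O` leaves no nontrivial normal `p'`-subgroup inside the image of `M`. Its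
order is odd, so the quaternion Sylow subgroups survive, and prime to `p`, so the `p`-part does too.
-/
theorem HasQuaternionSylow.hasAffineAction_of_odd (hQ : HasQuaternionSylow G) (hp2 : p ≠ 2)
    (hclass : PSubgroupsClassTwo p G) :
    HasAffineAction G (p ^ (Nat.card G).factorization p) := by
  obtain ⟨M, hMchar, hM, hmax⟩ := exists_characteristic_primesIn (· ≠ 2) G
  obtain ⟨O, hOchar, hO, hOmax⟩ := exists_characteristic_primesIn (· ≠ p) G
  rw [primesIn_ne_iff Nat.prime_two] at hM
  rw [primesIn_ne_iff hp.out] at hO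
  let K := M ⊓ O
  have hKp : ¬ p ∣ Nat.card K := fun h => hO (h.trans (Subgroup.card_dvd_of_le inf_le_right))
  have hK2 : ¬ 2 ∣ Nat.card K := fun h => hM (h.trans (Subgroup.card_dvd_of_le inf_le_left))
  have hKn : K.Normal := inferInstance
  have hMn : (M.map (QuotientGroup.mk' K)).Normal :=
    Subgroup.Normal.map inferInstance _ (QuotientGroup.mk'_surjective K)
  have hcard : ∀ (r : ℕ), r.Prime → ¬ r ∣ Nat.card K → ∀ L : Subgroup (G ⧸ K),
      ¬ r ∣ Nat.card L → PrimesIn (· ≠ r) (Nat.card (L.comap (QuotientGroup.mk' K))) :=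
    fun r hr hrK L hL => by
      rw [primesIn_ne_iff hr, Subgroup.card_comap_mk', hr.dvd_mul]
      exact not_or_intro hrK hL
  refine .of_quotient hKp (hasAffineAction_of_forall_eq_bot (hQ.quotient hK2) hp2
    (M := M.map (QuotientGroup.mk' K)) ?_ ?_ ?_
    (hclass.of_surjective (QuotientGroup.mk'_surjective K)))
  · exact fun h => hM (h.trans (Subgroup.card_map_dvd _ _))
  · intro L hLn hL
    rw [← Subgroup.map_comap_eq_self_of_surjective (QuotientGroup.mk'_surjective K) L]
    exact Subgroup.map_mono (hmax _ inferInstance (hcard 2 Nat.prime_two hK2 L hL))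
  · intro L hLn hLM hL
    have h1 : L.comap (QuotientGroup.mk' K) ≤ K := by
      refine le_inf ?_ (hOmax _ inferInstance (hcard p hp.out hKp L hL))
      refine (Subgroup.comap_mono hLM).trans ?_
      rw [Subgroup.comap_map_eq, QuotientGroup.ker_mk']
      exact sup_le le_rfl inf_le_left
    rw [Subgroup.eq_bot_iff_forall]
    intro x hx
    obtain ⟨g, rfl⟩ := QuotientGroup.mk_surjective x
    exact (QuotientGroup.eq_one_iff g).mpr (h1 hx)

end

theorem pSubgroupsClassTwo_of_nilpotencyClass_le {G : Type u} [Group G] [Finite G] {p : ℕ}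
    [Fact p.Prime] (h : ∀ P : Sylow p G, Group.nilpotencyClass P ≤ 2) :
    PSubgroupsClassTwo p G := by
  intro S hS a ha b hb c hc
  obtain ⟨P, hSP⟩ := hS.exists_le_sylow
  have hnil : Group.IsNilpotent P := P.isPGroup'.isNilpotent
  have htop := Subgroup.upperCentralSeries_eq_top_iff_nilpotencyClass_le.mpr (h P)
  have h1 : (⟨a, hSP ha⟩ : P) ∈ Subgroup.upperCentralSeries P 2 := htop ▸ Subgroup.mem_top _
  have h2 := Subgroup.mem_upperCentralSeries_succ_iff.mp
    (Subgroup.mem_upperCentralSeries_succ_iff.mp h1 ⟨b, hSP hb⟩) ⟨c, hSP hc⟩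
  rw [Subgroup.upperCentralSeries_zero, Subgroup.mem_bot] at h2
  exact congrArg Subtype.val h2

theorem theoremB (G : Type*) [Group G] [Finite G] (hsol : Group.IsSolvable G)
    (hclass : ∀ (p : ℕ), p.Prime → ∀ P : Sylow p G, Group.nilpotencyClass P ≤ 2)
    (hQ8 : ∀ P : Sylow 2 G, Nonempty (P ≃* QuaternionGroup 2)) :
    IsIYBGroup G := by
  refine HasAffineAction.isIYBGroup (HasAffineAction.card_of_forall_prime fun p hp => ?_)
  have : Fact p.Prime := ⟨hp⟩
  by_cases hp2 : p = 2
  · subst hp2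
    exact HasQuaternionSylow.hasAffineAction hQ8
  · exact HasQuaternionSylow.hasAffineAction_of_odd hQ8 hp2
      (pSubgroupsClassTwo_of_nilpotencyClass_le (hclass p hp))
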